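/- Let $Y$ be a smooth manifold and $\omega$ a smooth closed complex-valued $1$-form on $Y$, written $\omega=d\log u$ with $u$ a (generally multivalued) nowhere vanishing function: a branch of $u$ on an open set $V$ is a smooth $v:V\to\mathbb C^{*}$ with $dv=v\,\omega$. Let $i:D\hookrightarrow Y$ be a compact embedded smooth submanifold (of codimension one over $\mathbb C$, i.e. real codimension two, in the case of a complex hypersurface; the statement holds in every codimension). Write $\nabla=d-\omega\wedge$ on complex-valued smooth forms on $Y$ and $\nabla_D=d-i^{*}\omega\wedge$ on those of $D$. Let $H^p(D)=\ker\nabla_D/\operatorname{im}\nabla_D$, and let $H^{\bullet}(Y,D)$ be the cohomology of $\Omega^{p}(Y,D)=\Omega^{p}(Y)\oplus\Omega^{p-1}(D)$ with $\nabla(\varphi,\chi)=(\nabla\varphi,\ i^{*}\varphi-\nabla_D\chi)$ (where $\Omega^{-1}(D)=0$). The combinatorial Leray map is $\delta_D:H^p(D)\to H^{p+1}(Y,D)$, $[\psi]\mapsto[(0,\psi)]$. Let $U\subset Y$ be an open tubular neighbourhood of $D$ with projection $\pi:U\to D$: $\pi$ is a smooth retraction onto $D$, and a smooth locally trivial bundle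 whose fibres are open unit balls of a finite-dimensional normed space, with $D$ as zero section. Let $N$ be an open neighbourhood of $D$ and let $\theta:Y\to\mathbb R$ be a smooth step function, equal to $0$ on $N$ and with $\overline{\{\theta\neq1\}}\subset U$. Let $\psi\in\Omega^p(D)$, $p\ge 0$, with $\nabla_D\psi=0$. Then the ratio $u(y)/u(\pi(y))$, computed for $y\in U$ with a branch of $u$ on an open set containing the fibre of $\pi$ through $y$, exists and does not depend on the branch. Put $u\,\pi^{*}(\psi/u):=\frac{u}{u\circ\pi}\,\pi^{*}\psi$ on $U$, extended by zero to $Y$, and $$\delta_D^{(U)}(\psi):=\bigl(d\theta\wedge u\,\pi^{*}(\psi/u),\ 0\bigr)\in\Omega^{p+1}(Y,D).$$ This is a smooth relative form, it is $\nabla$-closed, it represents $\delta_D([\psi])$ in $H^{p+1}(Y,D)$, and it vanishes on $N$. Moreover $(\theta-1)\,u\,\pi^{*}(\psi/u)$ is a smooth $p$-form on $Y$, and $$\delta_D^{(U)}(\psi)-(0,\psi)=\nabla\bigl((\theta-1)\,u\,\pi^{*}(\psi/u),\ 0\bigr)=\bigl(\nabla\bigl((\theta-1)\,u\,\pi^{*}(\psi/u)\bigr),\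 i^{*}\bigl((\theta-1)\,u\,\pi^{*}(\psi/u)\bigr)\bigr).$$ -/

import Mathlib

open scoped Manifold ContDiff

noncomputable section

namespace Leray

section Forms

variable {E : Type*} [NormedAddCommGroup E] [NormedSpace ℝ E]
  {M : Type*} [TopologicalSpace M] [ChartedSpace E M]
  {E' : Type*} [NormedAddCommGroup E'] [NormedSpace ℝ E']
  {M' : Type*} [TopologicalSpace M'] [ChartedSpace E' M']

variable (E M) in
/-- A (not necessarily smooth) complex-valued differential `p`-form on the manifold `M` modelled
on the real vector space `E`. -/
def DForm (p : ℕ) : Type _ := (x : M) → TangentSpace 𝓘(ℝ, E) x [⋀^Fin p]→L[ℝ] ℂ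

instance (p : ℕ) : AddCommGroup (DForm E M p) :=
  inferInstanceAs (AddCommGroup ((x : M) → TangentSpace 𝓘(ℝ, E) x [⋀^Fin p]→L[ℝ] ℂ))

instance (p : ℕ) : Module ℂ (DForm E M p) :=
  inferInstanceAs (Module ℂ ((x : M) → TangentSpace 𝓘(ℝ, E) x [⋀^Fin p]→L[ℝ] ℂ))

theorem DForm.add_apply {p : ℕ} (φ ψ : DForm E M p) (x : M) : (φ + ψ) x = φ x + ψ x := rfl

theorem DForm.smul_apply {p : ℕ} (a : ℂ) (φ : DForm E M p) (x : M) : (a • φ) x = a • φ x := rfl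

/-- The expression of a form in the chart at `c`, i.e. its pullback under the inverse chart. -/
def inChart {p : ℕ} (c : M) (φ : DForm E M p) (e : E) : E [⋀^Fin p]→L[ℝ] ℂ :=
  (φ ((extChartAt 𝓘(ℝ, E) c).symm e)).compContinuousLinearMap
    (mfderiv 𝓘(ℝ, E) 𝓘(ℝ, E) (extChartAt 𝓘(ℝ, E) c).symm e)

theorem inChart_add {p : ℕ} (c : M) (φ ψ : DForm E M p) :
    inChart c (φ + ψ) = inChart c φ + inChart c ψ := rfl

theorem inChart_smul {p : ℕ} (c : M) (a : ℂ) (φ : DForm E M p) :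
    inChart c (a • φ) = a • inChart c φ := rfl

variable (E M) in
/-- The complex vector space `Ω^p(M)` of smooth complex-valued `p`-forms. -/
def smoothForms (p : ℕ) : Submodule ℂ (DForm E M p) where
  carrier := {φ | ∀ c : M, ContDiffOn ℝ ∞ (inChart c φ) (extChartAt 𝓘(ℝ, E) c).target}
  add_mem' := fun {φ ψ} hφ hψ c => by
    rw [inChart_add]; exact (hφ c).add (hψ c)
  zero_mem' := fun c => (contDiffOn_const (c := (0 : E [⋀^Fin p]→L[ℝ] ℂ)))
  smul_mem' := fun a φ hφ c => by
    rw [inChart_smul]; exact (hφ c).const_smul a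

/-- The exterior derivative, computed at `x` in the chart at `x`. -/
def extD {p : ℕ} (φ : DForm E M p) : DForm E M (p + 1) := fun x =>
  (extDeriv (inChart x φ) (extChartAt 𝓘(ℝ, E) x x)).compContinuousLinearMap
    (mfderiv 𝓘(ℝ, E) 𝓘(ℝ, E) (extChartAt 𝓘(ℝ, E) x) x)

/-- The wedge product on a vector space of a `1`-form and a `p`-form:
`(α ∧ φ)(v₀, …, v_p) = ∑ᵢ (-1)ⁱ α(vᵢ) φ(v₀, …, v̂ᵢ, …, v_p)`. -/
def wedgeAlt {p : ℕ} (α : E [⋀^Fin 1]→L[ℝ] ℂ) (φ : E [⋀^Fin p]→L[ℝ] ℂ) :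
    E [⋀^Fin (p + 1)]→L[ℝ] ℂ :=
  .alternatizeUncurryFin
    (((ContinuousAlternatingMap.ofSubsingleton ℝ E ℂ (0 : Fin 1)).symm α).smulRight φ)

/-- The wedge product `α ∧ φ` of a `1`-form and a `p`-form on a manifold. -/
def wedge {p : ℕ} (α : DForm E M 1) (φ : DForm E M p) : DForm E M (p + 1) :=
  fun x => wedgeAlt (E := E) (α x) (φ x)

/-- The differential of a complex-valued function, as a `1`-form. -/
def dFun (f : M → ℂ) : DForm E M 1 := fun x =>
  ContinuousAlternatingMap.ofSubsingleton ℝ (TangentSpace 𝓘(ℝ, E) x) ℂ (0 : Fin 1)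
    (mfderiv 𝓘(ℝ, E) 𝓘(ℝ, ℂ) f x)

/-- The pullback of forms along a map `f : M → M'`. -/
def pullback {p : ℕ} (f : M → M') : DForm E' M' p →ₗ[ℂ] DForm E M p where
  toFun φ := fun x =>
    (φ (f x)).compContinuousLinearMap (mfderiv 𝓘(ℝ, E) 𝓘(ℝ, E') f x)
  map_add' _ _ := rfl
  map_smul' _ _ := rfl

/-- The covariant derivative `∇φ = dφ - ω₀ ∧ φ`; for `ω₀ = d log u` this is `u d(φ / u)`. -/
def covD {p : ℕ} (ω₀ : DForm E M 1) (φ : DForm E M p) : DForm E M (p + 1) :=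
  extD φ - wedge ω₀ φ

theorem differentiableAt_inChart {p : ℕ} {φ : DForm E M p} (hφ : φ ∈ smoothForms E M p) (x : M) :
    DifferentiableAt ℝ (inChart x φ) (extChartAt 𝓘(ℝ, E) x x) :=
  ((hφ x).contDiffAt (extChartAt_target_mem_nhds x)).differentiableAt (by simp)

theorem extD_add {p : ℕ} {φ ψ : DForm E M p} (hφ : φ ∈ smoothForms E M p)
    (hψ : ψ ∈ smoothForms E M p) : extD (φ + ψ) = extD φ + extD ψ := by
  funext x
  rw [DForm.add_apply]
  simp only [extD, inChart_add,
    extDeriv_add (differentiableAt_inChart hφ x) (differentiableAt_inChart hψ x)]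
  rfl

theorem extD_smul {p : ℕ} (a : ℂ) {φ : DForm E M p} (hφ : φ ∈ smoothForms E M p) :
    extD (a • φ) = a • extD φ := by
  funext x
  have h : extDeriv (a • inChart x φ) (extChartAt 𝓘(ℝ, E) x x)
      = a • extDeriv (inChart x φ) (extChartAt 𝓘(ℝ, E) x x) := by
    simp only [extDeriv, fderiv_const_smul (differentiableAt_inChart hφ x) a]
    ext v
    simp [ContinuousAlternatingMap.alternatizeUncurryFin_apply, Finset.mul_sum]
  rw [DForm.smul_apply]
  simp only [extD, inChart_smul, h]
  rfl

theorem wedgeAlt_add {p : ℕ} (α : E [⋀^Fin 1]→L[ℝ] ℂ) (φ ψ : E [⋀^Fin p]→L[ℝ] ℂ) :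
    wedgeAlt α (φ + ψ) = wedgeAlt α φ + wedgeAlt α ψ := by
  ext v
  simp [wedgeAlt, ContinuousAlternatingMap.alternatizeUncurryFin_apply,
    Finset.sum_add_distrib]

theorem wedgeAlt_smul {p : ℕ} (α : E [⋀^Fin 1]→L[ℝ] ℂ) (a : ℂ) (φ : E [⋀^Fin p]→L[ℝ] ℂ) :
    wedgeAlt α (a • φ) = a • wedgeAlt α φ := by
  ext v
  simp only [wedgeAlt, ContinuousAlternatingMap.alternatizeUncurryFin_apply,
    ContinuousLinearMap.smulRight_apply, ContinuousAlternatingMap.smul_apply, Finset.smul_sum,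
    smul_comm a]

theorem wedge_add {p : ℕ} (α : DForm E M 1) (φ ψ : DForm E M p) :
    wedge α (φ + ψ) = wedge α φ + wedge α ψ :=
  funext fun x => wedgeAlt_add (E := E) (α x) (φ x) (ψ x)

theorem wedge_smul {p : ℕ} (α : DForm E M 1) (a : ℂ) (φ : DForm E M p) :
    wedge α (a • φ) = a • wedge α φ :=
  funext fun x => wedgeAlt_smul (E := E) (α x) a (φ x)

/-- The covariant derivative as a linear map on smooth forms. -/
def nabla {p : ℕ} (ω₀ : DForm E M 1) : smoothForms E M p →ₗ[ℂ] DForm E M (p + 1) where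
  toFun φ := covD ω₀ φ.1
  map_add' φ ψ := by
    simp only [covD, Submodule.coe_add, extD_add φ.2 ψ.2, wedge_add]
    abel
  map_smul' a φ := by
    simp only [covD, Submodule.coe_smul, extD_smul a φ.2, wedge_smul, smul_sub,
      RingHom.id_apply]

/-- Smooth `p`-forms `φ` with `∇φ = 0`. -/
def cocycles (ω₀ : DForm E M 1) (p : ℕ) : Submodule ℂ (DForm E M p) :=
  (LinearMap.ker (nabla (p := p) ω₀)).map (smoothForms E M p).subtype

/-- `∇`-exact `p`-forms (only `0` in degree `0`). -/
def coboundaries (ω₀ : DForm E M 1) : (p : ℕ) → Submodule ℂ (DForm E M p)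
  | 0 => ⊥
  | p + 1 => LinearMap.range (nabla (p := p) ω₀)

/-- Twisted de Rham cohomology `H^p(M; ∇)`. -/
abbrev Cohomology (ω₀ : DForm E M 1) (p : ℕ) : Type _ :=
  cocycles ω₀ p ⧸ (coboundaries ω₀ p).submoduleOf (cocycles ω₀ p)

/-! ### Relative cohomology

A relative form of degree `p + 1` is a pair `(φ, χ)` in `Ω^{p+1}(Y) ⊕ Ω^p(D)` (written
`θ φ + δ_D(χ)`), and `∇(φ, χ) = (∇φ, φ|_D - ∇χ)`.
Below `M = D`, `M' = Y` and `i` is the inclusion of `D` in `Y`. -/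

/-- The relative covariant derivative on smooth relative forms of degree `p + 1`. -/
def relNabla {p : ℕ} (i : M → M') (ω₀ : DForm E' M' 1) :
    (smoothForms E' M' (p + 1) × smoothForms E M p) →ₗ[ℂ]
      (DForm E' M' (p + 2) × DForm E M (p + 1)) :=
  (nabla ω₀ ∘ₗ LinearMap.fst ℂ _ _).prod
    ((pullback i ∘ₗ (smoothForms E' M' (p + 1)).subtype) ∘ₗ LinearMap.fst ℂ _ _
      - nabla (pullback i ω₀) ∘ₗ LinearMap.snd ℂ _ _)

/-- Smooth relative forms of degree `p + 1` annihilated by the relative covariant derivative. -/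
def relCocycles (i : M → M') (ω₀ : DForm E' M' 1) (p : ℕ) :
    Submodule ℂ (DForm E' M' (p + 1) × DForm E M p) :=
  (LinearMap.ker (relNabla (E := E) (p := p) i ω₀)).map
    ((smoothForms E' M' (p + 1)).subtype.prodMap (smoothForms E M p).subtype)

/-- Exact relative forms of degree `p + 1`: all `(∇η, η|_D - ∇ζ)` with `η ∈ Ω^p(Y)` and
`ζ ∈ Ω^{p-1}(D)` (with `Ω^{-1}(D) = 0`). -/
def relCoboundaries (i : M → M') (ω₀ : DForm E' M' 1) (p : ℕ) :
    Submodule ℂ (DForm E' M' (p + 1) × DForm E M p) :=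
  LinearMap.range
      ((nabla (p := p) ω₀).prod (pullback (E := E) i ∘ₗ (smoothForms E' M' p).subtype)) ⊔
    Submodule.prod ⊥ (coboundaries (pullback i ω₀) p)

/-- Twisted relative cohomology `H^{p+1}(Y, D; ∇)`. -/
abbrev RelCohomology (i : M → M') (ω₀ : DForm E' M' 1) (p : ℕ) : Type _ :=
  relCocycles (E := E) i ω₀ p ⧸
    (relCoboundaries (E := E) i ω₀ p).submoduleOf (relCocycles (E := E) i ω₀ p)

theorem inr_mem_relCocycles (i : M → M') (ω₀ : DForm E' M' 1) (p : ℕ) :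
    ∀ ψ ∈ cocycles (E := E) (pullback i ω₀) p,
      LinearMap.inr ℂ (DForm E' M' (p + 1)) (DForm E M p) ψ ∈ relCocycles (E := E) i ω₀ p := by
  rintro _ ⟨ψ, hψ, rfl⟩
  refine ⟨(0, ψ), ?_, by simp⟩
  have h : nabla (pullback i ω₀) ψ = 0 := hψ
  simp [relNabla, h]

/-- The combinatorial Leray map `δ_D : H^p(D; ∇_D) → H^{p+1}(Y, D; ∇)`, `[ψ] ↦ [(0, ψ)]`. -/
def lerayMap (i : M → M') (ω₀ : DForm E' M' 1) (p : ℕ) :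
    Cohomology (E := E) (pullback i ω₀) p →ₗ[ℂ] RelCohomology (E := E) i ω₀ p :=
  Submodule.mapQ _ _
    ((LinearMap.inr ℂ (DForm E' M' (p + 1)) (DForm E M p)).restrict
      (inr_mem_relCocycles i ω₀ p)) (by
    intro ψ hψ
    have h : (ψ : DForm E M p) ∈ coboundaries (pullback i ω₀) p := hψ
    change LinearMap.inr ℂ (DForm E' M' (p + 1)) (DForm E M p) ψ ∈ relCoboundaries i ω₀ p
    exact Submodule.mem_sup_right ⟨by simp, h⟩)

end Forms

section Tube

variable {E : Type*} [NormedAddCommGroup E] [NormedSpace ℝ E]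
  {Y : Type*} [TopologicalSpace Y] [ChartedSpace E Y]
  {E' : Type*} [NormedAddCommGroup E'] [NormedSpace ℝ E']
  {D : Type*} [TopologicalSpace D] [ChartedSpace E' D]

variable (E E') in
/-- `U` is a tubular neighbourhood of the submanifold `i : D → Y` with projection `π : U → D`
(the values of `π` outside `U` are irrelevant): `U` is open and contains `D`, `π` is a smooth
retraction of `U` onto `D`, and `π : U → D` is a smooth bundle of open unit balls of `F`, with `D`
as zero section. -/
structure IsTubularNeighbourhood (F : Type*) [NormedAddCommGroup F] [NormedSpace ℝ F]
    (i : D → Y) (U : Set Y) (π : Y → D) : Prop where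
  isOpen : IsOpen U
  incl_mem : ∀ x, i x ∈ U
  proj_incl : ∀ x, π (i x) = x
  smooth_proj : ContMDiffOn 𝓘(ℝ, E) 𝓘(ℝ, E') ∞ π U
  locally_trivial : ∀ x₀ : D, ∃ W : Set D, IsOpen W ∧ x₀ ∈ W ∧
    ∃ e : OpenPartialHomeomorph Y (D × F),
      e.source = U ∩ π ⁻¹' W ∧ e.target = W ×ˢ Metric.ball (0 : F) 1 ∧
      ContMDiffOn 𝓘(ℝ, E) (𝓘(ℝ, E').prod 𝓘(ℝ, F)) ∞ e e.source ∧
      ContMDiffOn (𝓘(ℝ, E').prod 𝓘(ℝ, F)) 𝓘(ℝ, E) ∞ e.symm e.target ∧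
      (∀ y ∈ e.source, (e y).1 = π y) ∧ ∀ x ∈ W, e (i x) = (x, 0)

/-- `v` is a (single-valued) branch on the open set `V` of the multivalued twist `u` with
`d log u = ω₀`. -/
structure IsBranch (ω₀ : DForm E Y 1) (V : Set Y) (v : Y → ℂ) : Prop where
  isOpen : IsOpen V
  smooth : ContMDiffOn 𝓘(ℝ, E) 𝓘(ℝ, ℂ) ∞ v V
  ne_zero : ∀ y ∈ V, v y ≠ 0
  dlog : ∀ y ∈ V, dFun v y = v y • ω₀ y

/-- `z` is the value at `y` of the ratio `u / (u ∘ π)`, computed with a branch of `u` near the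
whole fibre of `π : U → D` through `y` (i.e. `z` is the parallel transport between `π y` and `y`
along that fibre). -/
def IsTwistRatio (ω₀ : DForm E Y 1) (i : D → Y) (U : Set Y) (π : Y → D) (y : Y) (z : ℂ) : Prop :=
  ∃ (V : Set Y) (v : Y → ℂ), IsBranch ω₀ V v ∧ U ∩ π ⁻¹' {π y} ⊆ V ∧ z = v y / v (i (π y))

/-- The function `u / (u ∘ π)` on `U`, extended by zero. -/
def twistRatio (ω₀ : DForm E Y 1) (i : D → Y) (U : Set Y) (π : Y → D) : Y → ℂ :=
  U.indicator fun y => Classical.epsilon (IsTwistRatio ω₀ i U π y)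

/-- The form `u π^*(ψ / u)` on `U`, extended by zero. -/
def twistPullback {p : ℕ} (ω₀ : DForm E Y 1) (i : D → Y) (U : Set Y) (π : Y → D)
    (ψ : DForm E' D p) : DForm E Y p :=
  fun y => twistRatio ω₀ i U π y • pullback (E := E) π ψ y

/-- `θ` is a smooth step function which is `0` on the neighbourhood `N` of `D` and `1` outside a
closed subset of `U`. -/
structure IsStep (i : D → Y) (N U : Set Y) (θ : Y → ℝ) : Prop where
  isOpen : IsOpen N
  incl_mem : ∀ x, i x ∈ N
  smooth : ContMDiff 𝓘(ℝ, E) 𝓘(ℝ, ℝ) ∞ θ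
  eq_zero : ∀ y ∈ N, θ y = 0
  closure_subset : closure {y | θ y ≠ 1} ⊆ U

/-- The form `dθ ∧ u π^*(ψ / u)` on `Y`. -/
def lerayForm {p : ℕ} (ω₀ : DForm E Y 1) (i : D → Y) (U : Set Y) (π : Y → D) (θ : Y → ℝ)
    (ψ : DForm E' D p) : DForm E Y (p + 1) :=
  wedge (dFun fun y => (θ y : ℂ)) (twistPullback ω₀ i U π ψ)

/-- The form `(θ - 1) u π^*(ψ / u)` on `Y`. -/
def lerayPrimitive {p : ℕ} (ω₀ : DForm E Y 1) (i : D → Y) (U : Set Y) (π : Y → D) (θ : Y → ℝ)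
    (ψ : DForm E' D p) : DForm E Y p :=
  fun y => ((θ y : ℂ) - 1) • twistPullback ω₀ i U π ψ y

end Tube

end Leray

end

/-! A branch `v` of the twist conjugates the covariant derivative to the ordinary one: ∇(vφ) = v dφ
(`IsBranch.covD_fsmul`). The theorem therefore reduces to untwisted calculus wherever a branch
exists, and the tube is covered by such places. Over a small coordinate ball of D the tube is
diffeomorphic to a product of two balls. This product is convex, so the closed form ω₀ has a
primitive there, whose exponential is a branch (`IsTubularNeighbourhood.exists_isBranch`). On a
single fibre, again a ball, two branches differ by a constant factor
(`IsTubularNeighbourhood.ratio_eq_ratio`), so u/(u∘π) is well defined and equals v/(v∘i∘π).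

If ∇ψ = 0 on D, then χ = ψ/(v∘i) is closed, and u π^*(ψ/u) = vβ with β = π^*χ closed too. Put γ =
(θ-1)β. Since dβ = 0, dγ = dθ ∧ β, so the primitive is vγ and the Leray form is v dγ
(`IsTubularNeighbourhood.exists_lerayForm_eq`). Hence ∇ sends the primitive to the Leray form, and
d² = 0 makes the latter closed. Around a point outside U, θ is identically 1 and both forms vanish,
so the local statements on U extend to Y.

On D one has θ = 0, ratio 1 and π∘i = id, so the primitive restricts to -ψ. This gives the
difference formula, which exhibits the two representatives as cohomologous.

The calculus used here (smoothness, naturality of d, d² = 0, the Leibniz rule) is transferred from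
the model spaces through `inChart_pullback`. -/

noncomputable section

namespace Leray

open Filter Topology

/-! ### Pullbacks of forms and their coordinate expressions. -/

section Calculus

variable {E : Type*} [NormedAddCommGroup E] [NormedSpace ℝ E]
  {M : Type*} [TopologicalSpace M] [ChartedSpace E M]
  {E' : Type*} [NormedAddCommGroup E'] [NormedSpace ℝ E']
  {M' : Type*} [TopologicalSpace M'] [ChartedSpace E' M']
  {E'' : Type*} [NormedAddCommGroup E''] [NormedSpace ℝ E'']
  {M'' : Type*} [TopologicalSpace M''] [ChartedSpace E'' M''] {p : ℕ}

/-- The value of a form at a point, as an alternating map on the model space. -/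
abbrev DForm.val (φ : DForm E M p) (x : M) : E [⋀^Fin p]→L[ℝ] ℂ := φ x

variable (E E') in
/-- The derivative of a map at a point, as a linear map between the model spaces. -/
abbrev tangentMapAt (f : M → M') (x : M) : E →L[ℝ] E' := mfderiv 𝓘(ℝ, E) 𝓘(ℝ, E') f x

theorem pullback_val (f : M → M') (φ : DForm E' M' p) (x : M) :
    (pullback (E := E) f φ).val x
      = (φ.val (f x)).compContinuousLinearMap (tangentMapAt E E' f x) := rfl

theorem pullback_val_congr {φ : DForm E' M' p} {f g : M → M'} {x : M} (h : f =ᶠ[𝓝 x] g) :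
    (pullback (E := E) f φ).val x = (pullback (E := E) g φ).val x := by
  have h1 : tangentMapAt E E' f x = tangentMapAt E E' g x := h.mfderiv_eq
  rw [pullback_val, pullback_val, h.self_of_nhds, h1]

theorem pullback_comp_val {φ : DForm E'' M'' p} {f : M' → M''} {g : M → M'} {x : M}
    (hf : MDifferentiableAt 𝓘(ℝ, E') 𝓘(ℝ, E'') f (g x))
    (hg : MDifferentiableAt 𝓘(ℝ, E) 𝓘(ℝ, E') g x) :
    (pullback (E := E) (f ∘ g) φ).val x
      = (pullback (E := E) g (pullback (E := E') f φ)).val x := by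
  have h1 : tangentMapAt E E'' (f ∘ g) x
      = (tangentMapAt E' E'' f (g x)).comp (tangentMapAt E E' g x) := mfderiv_comp x hf hg
  rw [pullback_val, h1]
  rfl

theorem pullback_id_val (φ : DForm E M p) (x : M) :
    (pullback (E := E) id φ).val x = φ.val x := by
  have h1 : tangentMapAt E E (id : M → M) x = ContinuousLinearMap.id ℝ E := mfderiv_id
  rw [pullback_val, h1]
  rfl

theorem pullback_val_congr_form {φ φ' : DForm E' M' p} {f : M → M'} {x : M}
    (h : φ.val (f x) = φ'.val (f x)) :
    (pullback (E := E) f φ).val x = (pullback (E := E) f φ').val x := by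
  rw [pullback_val, pullback_val, h]

theorem pullback_vectorSpace_val (φ : DForm E' E' p) (g : E → E') (e : E) :
    (pullback (E := E) g φ).val e = (φ.val (g e)).compContinuousLinearMap (fderiv ℝ g e) := by
  have h1 : tangentMapAt E E' g e = fderiv ℝ g e := mfderiv_eq_fderiv
  rw [pullback_val, h1]

theorem inChart_eq_pullback (c : M) (φ : DForm E M p) :
    inChart c φ = pullback (E := E) (extChartAt 𝓘(ℝ, E) c).symm φ := rfl

theorem mdifferentiableAt_extChartAt_symm' [IsManifold 𝓘(ℝ, E) ∞ M] {c : M} {e : E}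
    (he : e ∈ (extChartAt 𝓘(ℝ, E) c).target) :
    MDifferentiableAt 𝓘(ℝ, E) 𝓘(ℝ, E) (extChartAt 𝓘(ℝ, E) c).symm e :=
  ((contMDiffOn_extChartAt_symm (n := ∞) c).contMDiffAt
    ((isOpen_extChartAt_target c).mem_nhds he)).mdifferentiableAt (by simp)

theorem contMDiffAt_extChartAt_symm' [IsManifold 𝓘(ℝ, E) ∞ M] {c : M} {e : E}
    (he : e ∈ (extChartAt 𝓘(ℝ, E) c).target) :
    ContMDiffAt 𝓘(ℝ, E) 𝓘(ℝ, E) ∞ (extChartAt 𝓘(ℝ, E) c).symm e :=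
  (contMDiffOn_extChartAt_symm (n := ∞) c).contMDiffAt ((isOpen_extChartAt_target c).mem_nhds he)

theorem contMDiffAt_extChartAt_of_mem_source [IsManifold 𝓘(ℝ, E) ∞ M] {c x : M}
    (hx : x ∈ (extChartAt 𝓘(ℝ, E) c).source) :
    ContMDiffAt 𝓘(ℝ, E) 𝓘(ℝ, E) ∞ (extChartAt 𝓘(ℝ, E) c) x :=
  contMDiffAt_extChartAt' (by simpa using hx)

/-- Functoriality of pullback: near `e`, `f` after the inverse chart factors as the inverse chart at
`c'` after the coordinate expression of `f`. This is the bridge by which facts about forms on vector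
spaces reach manifolds. -/
theorem inChart_pullback [IsManifold 𝓘(ℝ, E) ∞ M] [IsManifold 𝓘(ℝ, E') ∞ M']
    (φ : DForm E' M' p) {f : M → M'} {c : M} {c' : M'} {e : E}
    (he : e ∈ (extChartAt 𝓘(ℝ, E) c).target)
    (hfe : f ((extChartAt 𝓘(ℝ, E) c).symm e) ∈ (extChartAt 𝓘(ℝ, E') c').source)
    (hf : MDifferentiableAt 𝓘(ℝ, E) 𝓘(ℝ, E') f ((extChartAt 𝓘(ℝ, E) c).symm e)) :
    inChart c (pullback (E := E) f φ) e
      = ContinuousAlternatingMap.compContinuousLinearMap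
        (inChart c' φ (extChartAt 𝓘(ℝ, E') c' (f ((extChartAt 𝓘(ℝ, E) c).symm e))))
        (fderiv ℝ (extChartAt 𝓘(ℝ, E') c' ∘ f ∘ (extChartAt 𝓘(ℝ, E) c).symm) e) := by
  have hs := mdifferentiableAt_extChartAt_symm' he
  have hfs : MDifferentiableAt 𝓘(ℝ, E) 𝓘(ℝ, E') (f ∘ (extChartAt 𝓘(ℝ, E) c).symm) e :=
    hf.comp e hs
  have hg : MDifferentiableAt 𝓘(ℝ, E) 𝓘(ℝ, E')
      (extChartAt 𝓘(ℝ, E') c' ∘ f ∘ (extChartAt 𝓘(ℝ, E) c).symm) e :=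
    (((contMDiffAt_extChartAt_of_mem_source hfe).mdifferentiableAt (by simp))).comp e hfs
  have hev : f ∘ (extChartAt 𝓘(ℝ, E) c).symm =ᶠ[𝓝 e] (extChartAt 𝓘(ℝ, E') c').symm ∘
      (extChartAt 𝓘(ℝ, E') c' ∘ f ∘ (extChartAt 𝓘(ℝ, E) c).symm) := by
    filter_upwards [hfs.continuousAt.preimage_mem_nhds
      ((isOpen_extChartAt_source c').mem_nhds hfe)] with a ha
    exact ((extChartAt 𝓘(ℝ, E') c').left_inv ha).symm
  have h1 : inChart c (pullback (E := E) f φ) e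
      = (pullback (E := E) (f ∘ (extChartAt 𝓘(ℝ, E) c).symm) φ).val e :=
    (pullback_comp_val hf hs).symm
  rw [h1, pullback_val_congr hev, pullback_comp_val
    (g := extChartAt 𝓘(ℝ, E') c' ∘ f ∘ (extChartAt 𝓘(ℝ, E) c).symm)
    (mdifferentiableAt_extChartAt_symm' ((extChartAt 𝓘(ℝ, E') c').map_source hfe)) hg,
    pullback_vectorSpace_val]
  rfl

/-- Continuous alternating maps on a finite-dimensional space are determined, linearly, by their
values at finitely many tuples. -/
theorem exists_leftInverse_eval [FiniteDimensional ℝ E] (p : ℕ) :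
    ∃ (κ : Type) (_ : Fintype κ) (b : κ → Fin p → E) (R : (κ → ℂ) →L[ℝ] (E [⋀^Fin p]→L[ℝ] ℂ)),
      ∀ φ : E [⋀^Fin p]→L[ℝ] ℂ, R (fun k => φ (b k)) = φ := by
  let B := Module.finBasis ℝ E
  let ev : (E [⋀^Fin p]→L[ℝ] ℂ) →ₗ[ℝ] ((Fin p → Fin (Module.finrank ℝ E)) → ℂ) :=
    { toFun := fun φ k => φ fun j => B (k j)
      map_add' := fun _ _ => rfl
      map_smul' := fun _ _ => rfl }
  have hev : LinearMap.ker ev = ⊥ := by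
    refine LinearMap.ker_eq_bot.2 fun φ ψ h => ?_
    refine ContinuousAlternatingMap.toAlternatingMap_injective ?_
    exact AlternatingMap.coe_multilinearMap_injective
      (Module.Basis.ext_multilinear (fun _ => B) fun k => congrFun h k)
  -- Any linear left inverse of the injective evaluation map will do; it is continuous because it
  -- starts from a finite-dimensional space.
  obtain ⟨R, hR⟩ := ev.exists_leftInverse_of_injective hev
  exact ⟨Fin p → Fin (Module.finrank ℝ E), inferInstance, fun k j => B (k j),
    LinearMap.toContinuousLinearMap R, fun φ => LinearMap.congr_fun hR φ⟩

/-- The pulled-back alternating map is recovered linearly from finitely many values, and each value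
`a y (L y b₁, …)` is smooth because evaluation is analytic jointly in the multilinear map and its
arguments. -/
theorem contDiffAt_compContinuousLinearMap [FiniteDimensional ℝ E] {G : Type*}
    [NormedAddCommGroup G] [NormedSpace ℝ G] {a : G → E' [⋀^Fin p]→L[ℝ] ℂ} {L : G → E →L[ℝ] E'}
    {x : G} (ha : ContDiffAt ℝ ∞ a x) (hL : ContDiffAt ℝ ∞ L x) :
    ContDiffAt ℝ ∞ (fun y => (a y).compContinuousLinearMap (L y)) x := by
  obtain ⟨κ, _, b, R, hR⟩ := exists_leftInverse_eval (E := E) p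
  have h : ∀ y, (a y).compContinuousLinearMap (L y) = R fun k => a y fun j => L y (b k j) :=
    fun y => (hR _).symm
  simp only [h]
  refine R.contDiff.contDiffAt.comp x (contDiffAt_pi.2 fun k => ?_)
  have han := (ContinuousLinearMap.analyticAt_uncurry_of_multilinear (𝕜 := ℝ)
    (ContinuousAlternatingMap.toContinuousMultilinearMapCLM ℝ (𝕜 := ℝ) (E := E') (F := ℂ)
      (ι := Fin p)) (x := (a x, fun j => L x (b k j)))).contDiffAt (n := ∞)
  exact han.comp x (ha.prodMk (contDiffAt_pi.2 fun j => hL.clm_apply contDiffAt_const))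


/-! ### Smoothness and the exterior derivative as local notions. -/

theorem extChartAt_symm_tendsto {c x : M} (hx : x ∈ (extChartAt 𝓘(ℝ, E) c).source) :
    Tendsto (extChartAt 𝓘(ℝ, E) c).symm (𝓝 (extChartAt 𝓘(ℝ, E) c x)) (𝓝 x) := by
  have h := continuousAt_extChartAt_symm'' (I := 𝓘(ℝ, E))
    ((extChartAt 𝓘(ℝ, E) c).map_source hx)
  rwa [ContinuousAt, (extChartAt 𝓘(ℝ, E) c).left_inv hx] at h

theorem eventually_mem_extChartAt_target {c x : M} (hx : x ∈ (extChartAt 𝓘(ℝ, E) c).source) :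
    ∀ᶠ e in 𝓝 (extChartAt 𝓘(ℝ, E) c x), e ∈ (extChartAt 𝓘(ℝ, E) c).target :=
  (isOpen_extChartAt_target c).mem_nhds ((extChartAt 𝓘(ℝ, E) c).map_source hx)

theorem inChart_congr {φ ψ : DForm E M p} {c x : M} (hx : x ∈ (extChartAt 𝓘(ℝ, E) c).source)
    (h : ∀ᶠ y in 𝓝 x, φ.val y = ψ.val y) :
    inChart c φ =ᶠ[𝓝 (extChartAt 𝓘(ℝ, E) c x)] inChart c ψ := by
  filter_upwards [(extChartAt_symm_tendsto hx).eventually h] with e he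
  exact pullback_val_congr_form he

theorem pullback_id (φ : DForm E M p) : pullback (E := E) id φ = φ :=
  funext fun x => pullback_id_val φ x

/-- A form is smooth at a point if its expression in the chart there is. -/
def SmoothFormAt (φ : DForm E M p) (x : M) : Prop :=
  ContDiffAt ℝ ∞ (inChart x φ) (extChartAt 𝓘(ℝ, E) x x)

theorem SmoothFormAt.congr {φ ψ : DForm E M p} {x : M} (hψ : SmoothFormAt ψ x)
    (h : ∀ᶠ y in 𝓝 x, φ.val y = ψ.val y) : SmoothFormAt φ x :=
  ContDiffAt.congr_of_eventuallyEq hψ (inChart_congr (mem_extChartAt_source x) h)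

theorem extD_val (φ : DForm E M p) (x : M) :
    (extD φ).val x = ContinuousAlternatingMap.compContinuousLinearMap
      (extDeriv (inChart x φ) (extChartAt 𝓘(ℝ, E) x x))
      (tangentMapAt E E (extChartAt 𝓘(ℝ, E) x) x) := rfl

theorem extD_val_congr {φ ψ : DForm E M p} {x : M} (h : ∀ᶠ y in 𝓝 x, φ.val y = ψ.val y) :
    (extD φ).val x = (extD ψ).val x := by
  rw [extD_val, extD_val, (inChart_congr (mem_extChartAt_source x) h).extDeriv_eq]

/-! ### Chart independence, naturality of d, and d² = 0. -/

section Smooth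

variable [IsManifold 𝓘(ℝ, E) ∞ M] [IsManifold 𝓘(ℝ, E') ∞ M']

theorem inChart_pullback_eventuallyEq (φ : DForm E' M' p) {f : M → M'} {c x : M} {c' : M'}
    (hx : x ∈ (extChartAt 𝓘(ℝ, E) c).source) (hfx : f x ∈ (extChartAt 𝓘(ℝ, E') c').source)
    (hf : ContMDiffAt 𝓘(ℝ, E) 𝓘(ℝ, E') ∞ f x) :
    inChart c (pullback (E := E) f φ) =ᶠ[𝓝 (extChartAt 𝓘(ℝ, E) c x)] fun e =>
      ContinuousAlternatingMap.compContinuousLinearMap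
        (inChart c' φ ((extChartAt 𝓘(ℝ, E') c' ∘ f ∘ (extChartAt 𝓘(ℝ, E) c).symm) e))
        (fderiv ℝ (extChartAt 𝓘(ℝ, E') c' ∘ f ∘ (extChartAt 𝓘(ℝ, E) c).symm) e) := by
  -- Smoothness of order ∞ at a point need not spread to a neighbourhood, since the neighbourhood
  -- may shrink with the order. Order 1 does spread, and only differentiability is needed.
  have hf1 : ∀ᶠ y in 𝓝 x, ContMDiffAt 𝓘(ℝ, E) 𝓘(ℝ, E') 1 f y :=
    (contMDiffAt_iff_contMDiffAt_nhds (by simp)).1 (hf.of_le (by exact_mod_cast le_top))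
  have hs := extChartAt_symm_tendsto hx
  filter_upwards [eventually_mem_extChartAt_target hx, hs.eventually hf1,
    hs.eventually (hf.continuousAt.preimage_mem_nhds ((isOpen_extChartAt_source c').mem_nhds hfx))]
    with e he h1 h2
  exact inChart_pullback φ he h2 (h1.mdifferentiableAt (by simp))

theorem contDiffAt_chart_transition {f : M → M'} {c x : M} {c' : M'}
    (hx : x ∈ (extChartAt 𝓘(ℝ, E) c).source) (hfx : f x ∈ (extChartAt 𝓘(ℝ, E') c').source)
    (hf : ContMDiffAt 𝓘(ℝ, E) 𝓘(ℝ, E') ∞ f x) :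
    ContDiffAt ℝ ∞ (extChartAt 𝓘(ℝ, E') c' ∘ f ∘ (extChartAt 𝓘(ℝ, E) c).symm)
      (extChartAt 𝓘(ℝ, E) c x) := by
  rw [← contMDiffAt_iff_contDiffAt]
  have h : (extChartAt 𝓘(ℝ, E) c).symm (extChartAt 𝓘(ℝ, E) c x) = x :=
    (extChartAt 𝓘(ℝ, E) c).left_inv hx
  refine ContMDiffAt.comp _ (contMDiffAt_extChartAt_of_mem_source
    (by rw [Function.comp_apply, h]; exact hfx)) ?_
  exact ContMDiffAt.comp _ (by rwa [h])
    (contMDiffAt_extChartAt_symm' ((extChartAt 𝓘(ℝ, E) c).map_source hx))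

theorem contDiffAt_inChart_pullback [FiniteDimensional ℝ E] {φ : DForm E' M' p} {f : M → M'}
    {c x : M} {c' : M'}
    (hx : x ∈ (extChartAt 𝓘(ℝ, E) c).source) (hfx : f x ∈ (extChartAt 𝓘(ℝ, E') c').source)
    (hf : ContMDiffAt 𝓘(ℝ, E) 𝓘(ℝ, E') ∞ f x)
    (hφ : ContDiffAt ℝ ∞ (inChart c' φ) (extChartAt 𝓘(ℝ, E') c' (f x))) :
    ContDiffAt ℝ ∞ (inChart c (pullback (E := E) f φ)) (extChartAt 𝓘(ℝ, E) c x) := by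
  refine ContDiffAt.congr_of_eventuallyEq ?_ (inChart_pullback_eventuallyEq φ hx hfx hf)
  have hg := contDiffAt_chart_transition hx hfx hf
  refine contDiffAt_compContinuousLinearMap
    (ContDiffAt.comp (g := inChart c' φ) _ ?_ hg) (hg.fderiv_right (by simp))
  rwa [Function.comp_apply, Function.comp_apply, (extChartAt 𝓘(ℝ, E) c).left_inv hx]

/-- A change of chart is the pullback along `id` read in two different charts. -/
theorem smoothFormAt_iff_inChart [FiniteDimensional ℝ E] {φ : DForm E M p} {c x : M}
    (hx : x ∈ (extChartAt 𝓘(ℝ, E) c).source) :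
    SmoothFormAt φ x ↔ ContDiffAt ℝ ∞ (inChart c φ) (extChartAt 𝓘(ℝ, E) c x) := by
  have h : ∀ {a b : M}, x ∈ (extChartAt 𝓘(ℝ, E) a).source → x ∈ (extChartAt 𝓘(ℝ, E) b).source →
      ContDiffAt ℝ ∞ (inChart b φ) (extChartAt 𝓘(ℝ, E) b x) →
      ContDiffAt ℝ ∞ (inChart a φ) (extChartAt 𝓘(ℝ, E) a x) := fun ha hb hφ => by
    have := contDiffAt_inChart_pullback (f := id) ha hb contMDiffAt_id hφ
    rwa [pullback_id] at this
  exact ⟨h hx (mem_extChartAt_source x), h (mem_extChartAt_source x) hx⟩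

theorem mem_smoothForms_iff [FiniteDimensional ℝ E] {φ : DForm E M p} :
    φ ∈ smoothForms E M p ↔ ∀ x, SmoothFormAt φ x := by
  refine ⟨fun h x => (h x).contDiffAt (extChartAt_target_mem_nhds x), fun h c e he => ?_⟩
  have := (smoothFormAt_iff_inChart (φ := φ) ((extChartAt 𝓘(ℝ, E) c).map_target he)).1 (h _)
  rw [(extChartAt 𝓘(ℝ, E) c).right_inv he] at this
  exact this.contDiffWithinAt

theorem SmoothFormAt.pullback [FiniteDimensional ℝ E] {φ : DForm E' M' p} {f : M → M'} {x : M}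
    (hφ : SmoothFormAt φ (f x)) (hf : ContMDiffAt 𝓘(ℝ, E) 𝓘(ℝ, E') ∞ f x) :
    SmoothFormAt (Leray.pullback (E := E) f φ) x :=
  contDiffAt_inChart_pullback (mem_extChartAt_source x) (mem_extChartAt_source _) hf hφ

theorem extDeriv_inChart_pullback {φ : DForm E' M' p} {f : M → M'} {c x : M} {c' : M'}
    (hx : x ∈ (extChartAt 𝓘(ℝ, E) c).source) (hfx : f x ∈ (extChartAt 𝓘(ℝ, E') c').source)
    (hf : ContMDiffAt 𝓘(ℝ, E) 𝓘(ℝ, E') ∞ f x)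
    (hφ : ContDiffAt ℝ ∞ (inChart c' φ) (extChartAt 𝓘(ℝ, E') c' (f x))) :
    extDeriv (inChart c (pullback (E := E) f φ)) (extChartAt 𝓘(ℝ, E) c x)
      = ContinuousAlternatingMap.compContinuousLinearMap
        (extDeriv (inChart c' φ) (extChartAt 𝓘(ℝ, E') c' (f x)))
        (fderiv ℝ (extChartAt 𝓘(ℝ, E') c' ∘ f ∘ (extChartAt 𝓘(ℝ, E) c).symm)
          (extChartAt 𝓘(ℝ, E) c x)) := by
  have hg := contDiffAt_chart_transition hx hfx hf
  have he : (extChartAt 𝓘(ℝ, E') c' ∘ f ∘ (extChartAt 𝓘(ℝ, E) c).symm)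
      (extChartAt 𝓘(ℝ, E) c x) = extChartAt 𝓘(ℝ, E') c' (f x) := by
    rw [Function.comp_apply, Function.comp_apply, (extChartAt 𝓘(ℝ, E) c).left_inv hx]
  rw [(inChart_pullback_eventuallyEq φ hx hfx hf).extDeriv_eq]
  refine (extDeriv_pullback (r := ∞) ?_ hg (by simpa using ENat.LEInfty.out)).trans ?_
  · rw [he]
    exact hφ.differentiableAt (by simp)
  · rw [he]

/-- Both sides are the derivative at `x` of the chart at `c'` after `f`, expanded by the chain rule
in two ways. It converts the coordinate Jacobian into the intrinsic derivative of `f`. -/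
theorem fderiv_chart_transition {f : M → M'} {c x : M} {c' : M'}
    (hx : x ∈ (extChartAt 𝓘(ℝ, E) c).source) (hfx : f x ∈ (extChartAt 𝓘(ℝ, E') c').source)
    (hf : ContMDiffAt 𝓘(ℝ, E) 𝓘(ℝ, E') ∞ f x) :
    (fderiv ℝ (extChartAt 𝓘(ℝ, E') c' ∘ f ∘ (extChartAt 𝓘(ℝ, E) c).symm)
        (extChartAt 𝓘(ℝ, E) c x)).comp (tangentMapAt E E (extChartAt 𝓘(ℝ, E) c) x)
      = (tangentMapAt E' E' (extChartAt 𝓘(ℝ, E') c') (f x)).comp (tangentMapAt E E' f x) := by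
  set g := extChartAt 𝓘(ℝ, E') c' ∘ f ∘ (extChartAt 𝓘(ℝ, E) c).symm with hg
  have hgd : ContDiffAt ℝ ∞ g (extChartAt 𝓘(ℝ, E) c x) := contDiffAt_chart_transition hx hfx hf
  have h1 : tangentMapAt E E' (g ∘ extChartAt 𝓘(ℝ, E) c) x
      = (tangentMapAt E E' g (extChartAt 𝓘(ℝ, E) c x)).comp
        (tangentMapAt E E (extChartAt 𝓘(ℝ, E) c) x) :=
    mfderiv_comp x (hgd.contMDiffAt.mdifferentiableAt (by simp))
      ((contMDiffAt_extChartAt_of_mem_source hx).mdifferentiableAt (by simp))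
  have h2 : tangentMapAt E E' (extChartAt 𝓘(ℝ, E') c' ∘ f) x
      = (tangentMapAt E' E' (extChartAt 𝓘(ℝ, E') c') (f x)).comp (tangentMapAt E E' f x) :=
    mfderiv_comp x ((contMDiffAt_extChartAt_of_mem_source hfx).mdifferentiableAt (by simp))
      (hf.mdifferentiableAt (by simp))
  have h3 : tangentMapAt E E' g (extChartAt 𝓘(ℝ, E) c x)
      = fderiv ℝ g (extChartAt 𝓘(ℝ, E) c x) := mfderiv_eq_fderiv
  have h4 : g ∘ extChartAt 𝓘(ℝ, E) c =ᶠ[𝓝 x] extChartAt 𝓘(ℝ, E') c' ∘ f := by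
    filter_upwards [(isOpen_extChartAt_source c).mem_nhds hx] with y hy
    rw [hg, Function.comp_apply, Function.comp_apply, Function.comp_apply,
      (extChartAt 𝓘(ℝ, E) c).left_inv hy, Function.comp_apply]
  have h5 : tangentMapAt E E' (g ∘ extChartAt 𝓘(ℝ, E) c) x
      = tangentMapAt E E' (extChartAt 𝓘(ℝ, E') c' ∘ f) x := h4.mfderiv_eq
  rw [← h2, ← h5, h1, h3]

/-- The exterior derivative commutes with pullback. -/
theorem extD_pullback {φ : DForm E' M' p} {f : M → M'} {x : M} (hφ : SmoothFormAt φ (f x))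
    (hf : ContMDiffAt 𝓘(ℝ, E) 𝓘(ℝ, E') ∞ f x) :
    (extD (pullback (E := E) f φ)).val x = (pullback (E := E) f (extD φ)).val x := by
  have hx := mem_extChartAt_source (I := 𝓘(ℝ, E)) x
  have hfx := mem_extChartAt_source (I := 𝓘(ℝ, E')) (f x)
  rw [extD_val, extDeriv_inChart_pullback hx hfx hf hφ, pullback_val, extD_val]
  exact congrArg (ContinuousAlternatingMap.compContinuousLinearMap
    (extDeriv (inChart (f x) φ) (extChartAt 𝓘(ℝ, E') (f x) (f x))))
    (fderiv_chart_transition hx hfx hf)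

theorem tangentMapAt_extChartAt_comp_symm {c : M} {e : E}
    (he : e ∈ (extChartAt 𝓘(ℝ, E) c).target) :
    (tangentMapAt E E (extChartAt 𝓘(ℝ, E) c) ((extChartAt 𝓘(ℝ, E) c).symm e)).comp
      (tangentMapAt E E (extChartAt 𝓘(ℝ, E) c).symm e) = ContinuousLinearMap.id ℝ E := by
  have h1 : tangentMapAt E E (extChartAt 𝓘(ℝ, E) c ∘ (extChartAt 𝓘(ℝ, E) c).symm) e = _ :=
    mfderiv_comp e ((contMDiffAt_extChartAt_of_mem_source
      ((extChartAt 𝓘(ℝ, E) c).map_target he)).mdifferentiableAt (by simp))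
      (mdifferentiableAt_extChartAt_symm' he)
  have h2 : extChartAt 𝓘(ℝ, E) c ∘ (extChartAt 𝓘(ℝ, E) c).symm =ᶠ[𝓝 e] id := by
    filter_upwards [(isOpen_extChartAt_target c).mem_nhds he] with y hy
    exact (extChartAt 𝓘(ℝ, E) c).right_inv hy
  have h3 : tangentMapAt E E (extChartAt 𝓘(ℝ, E) c ∘ (extChartAt 𝓘(ℝ, E) c).symm) e
      = tangentMapAt E E (id : E → E) e := h2.mfderiv_eq
  exact h1.symm.trans (h3.trans mfderiv_id)

theorem tangentMapAt_extChartAt_symm_comp (x : M) :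
    (tangentMapAt E E (extChartAt 𝓘(ℝ, E) x).symm (extChartAt 𝓘(ℝ, E) x x)).comp
      (tangentMapAt E E (extChartAt 𝓘(ℝ, E) x) x) = ContinuousLinearMap.id ℝ E := by
  have hx := mem_extChartAt_source (I := 𝓘(ℝ, E)) x
  have h1 : tangentMapAt E E ((extChartAt 𝓘(ℝ, E) x).symm ∘ extChartAt 𝓘(ℝ, E) x) x = _ :=
    mfderiv_comp x (mdifferentiableAt_extChartAt_symm' ((extChartAt 𝓘(ℝ, E) x).map_source hx))
      ((contMDiffAt_extChartAt_of_mem_source hx).mdifferentiableAt (by simp))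
  have h2 : (extChartAt 𝓘(ℝ, E) x).symm ∘ extChartAt 𝓘(ℝ, E) x =ᶠ[𝓝 x] id := by
    filter_upwards [(isOpen_extChartAt_source x).mem_nhds hx] with y hy
    exact (extChartAt 𝓘(ℝ, E) x).left_inv hy
  have h3 : tangentMapAt E E ((extChartAt 𝓘(ℝ, E) x).symm ∘ extChartAt 𝓘(ℝ, E) x) x
      = tangentMapAt E E (id : M → M) x := h2.mfderiv_eq
  exact h1.symm.trans (h3.trans mfderiv_id)

/-- The exterior derivative may be computed in any chart. -/
theorem inChart_extD {φ : DForm E M p} {c : M} {e : E} (he : e ∈ (extChartAt 𝓘(ℝ, E) c).target)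
    (hφ : SmoothFormAt φ ((extChartAt 𝓘(ℝ, E) c).symm e)) :
    inChart c (extD φ) e = extDeriv (inChart c φ) e := by
  obtain ⟨x, hx⟩ : ∃ x, x = (extChartAt 𝓘(ℝ, E) c).symm e := ⟨_, rfl⟩
  have hxc : x ∈ (extChartAt 𝓘(ℝ, E) c).source := hx ▸ (extChartAt 𝓘(ℝ, E) c).map_target he
  have hex : extChartAt 𝓘(ℝ, E) c x = e := by rw [hx, (extChartAt 𝓘(ℝ, E) c).right_inv he]
  rw [← hx] at hφ
  have hxx := mem_extChartAt_source (I := 𝓘(ℝ, E)) x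
  -- The definition of `extD` at `x` uses the chart at `x`; the identity map read from the chart at
  -- `c` to the chart at `x` compares the two.
  have h1 := extDeriv_inChart_pullback (φ := φ) (f := id) hxc hxx contMDiffAt_id hφ
  have h2 := fderiv_chart_transition (f := id) hxc hxx contMDiffAt_id
  rw [pullback_id] at h1
  have h3 : inChart c (extD φ) e = ContinuousAlternatingMap.compContinuousLinearMap
      ((extD φ).val x) (tangentMapAt E E (extChartAt 𝓘(ℝ, E) c).symm e) := by rw [hx]; rfl
  have h4 : tangentMapAt E E (id : M → M) x = ContinuousLinearMap.id ℝ E := mfderiv_id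
  have h5 := tangentMapAt_extChartAt_comp_symm he
  rw [← hx] at h5
  rw [h4] at h2
  have h6 : tangentMapAt E E (extChartAt 𝓘(ℝ, E) x) x
      = (fderiv ℝ (extChartAt 𝓘(ℝ, E) x ∘ id ∘ (extChartAt 𝓘(ℝ, E) c).symm)
        (extChartAt 𝓘(ℝ, E) c x)).comp (tangentMapAt E E (extChartAt 𝓘(ℝ, E) c) x) := h2.symm
  rw [hex] at h1 h6
  rw [h3, extD_val, h1, h6]
  have h7 : ((fderiv ℝ (extChartAt 𝓘(ℝ, E) x ∘ id ∘ (extChartAt 𝓘(ℝ, E) c).symm) e).comp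
      (tangentMapAt E E (extChartAt 𝓘(ℝ, E) c) x)).comp
        (tangentMapAt E E (extChartAt 𝓘(ℝ, E) c).symm e)
      = fderiv ℝ (extChartAt 𝓘(ℝ, E) x ∘ id ∘ (extChartAt 𝓘(ℝ, E) c).symm) e := by
    rw [ContinuousLinearMap.comp_assoc, h5, ContinuousLinearMap.comp_id]
  exact congrArg (ContinuousAlternatingMap.compContinuousLinearMap
    (extDeriv (inChart x φ) (extChartAt 𝓘(ℝ, E) x x))) h7

theorem inChart_extD_eventuallyEq {φ : DForm E M p} {x : M}
    (hφ : ∀ᶠ y in 𝓝 x, SmoothFormAt φ y) :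
    inChart x (extD φ) =ᶠ[𝓝 (extChartAt 𝓘(ℝ, E) x x)] extDeriv (inChart x φ) := by
  have hx := mem_extChartAt_source (I := 𝓘(ℝ, E)) x
  filter_upwards [eventually_mem_extChartAt_target hx,
    (extChartAt_symm_tendsto hx).eventually hφ] with e he h
  exact inChart_extD he h

theorem SmoothFormAt.extD {φ : DForm E M p} {x : M} (hφ : ∀ᶠ y in 𝓝 x, SmoothFormAt φ y) :
    SmoothFormAt (extD φ) x := by
  refine ContDiffAt.congr_of_eventuallyEq ?_ (inChart_extD_eventuallyEq hφ)
  have h : SmoothFormAt φ x := hφ.self_of_nhds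
  exact (ContinuousAlternatingMap.alternatizeUncurryFinCLM ℝ E ℂ).contDiff.contDiffAt.comp _
    (ContDiffAt.fderiv_right (m := ∞) h (by simp))

/-- The outer derivative sees the inner one on a whole neighbourhood, where each point uses its own
chart. Chart independence replaces all of these by the single chart at `x`, where d² = 0 is the
vector-space fact. -/
theorem extD_extD {φ : DForm E M p} {x : M} (hφ : ∀ᶠ y in 𝓝 x, SmoothFormAt φ y) :
    (extD (extD φ)).val x = 0 := by
  rw [extD_val, (inChart_extD_eventuallyEq hφ).extDeriv_eq,
    extDeriv_extDeriv_apply (r := ∞) hφ.self_of_nhds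
      (by simpa using ENat.LEInfty.out)]
  rfl

end Smooth

/-! ### Products with functions and the Leibniz rule. -/

/-- The product of a form with a function. -/
def fsmul (f : M → ℂ) (φ : DForm E M p) : DForm E M p := fun x => f x • φ x

theorem inChart_fsmul (f : M → ℂ) (φ : DForm E M p) (c : M) :
    inChart c (fsmul f φ) = fun e => f ((extChartAt 𝓘(ℝ, E) c).symm e) • inChart c φ e := rfl

section Smooth

variable [IsManifold 𝓘(ℝ, E) ∞ M] [IsManifold 𝓘(ℝ, E') ∞ M']

theorem contDiffAt_comp_extChartAt_symm {f : M → ℂ} {x : M}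
    (hf : ContMDiffAt 𝓘(ℝ, E) 𝓘(ℝ, ℂ) ∞ f x) :
    ContDiffAt ℝ ∞ (fun e => f ((extChartAt 𝓘(ℝ, E) x).symm e)) (extChartAt 𝓘(ℝ, E) x x) := by
  rw [← contMDiffAt_iff_contDiffAt]
  have h : (extChartAt 𝓘(ℝ, E) x).symm (extChartAt 𝓘(ℝ, E) x x) = x := extChartAt_to_inv x
  exact ContMDiffAt.comp _ (by rwa [h]) (contMDiffAt_extChartAt_symm' (mem_extChartAt_target x))

theorem contDiffAt_function_smul {F : E → ℂ} {A : E → E [⋀^Fin p]→L[ℝ] ℂ} {e : E}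
    (hF : ContDiffAt ℝ ∞ F e) (hA : ContDiffAt ℝ ∞ A e) :
    ContDiffAt ℝ ∞ (fun e => F e • A e) e :=
  hF.fun_smul hA

theorem SmoothFormAt.fsmul {f : M → ℂ} {φ : DForm E M p} {x : M}
    (hf : ContMDiffAt 𝓘(ℝ, E) 𝓘(ℝ, ℂ) ∞ f x) (hφ : SmoothFormAt φ x) :
    SmoothFormAt (fsmul f φ) x :=
  contDiffAt_function_smul (contDiffAt_comp_extChartAt_symm hf) hφ

theorem extDeriv_function_smul {F : E → ℂ} {A : E → E [⋀^Fin p]→L[ℝ] ℂ} {e : E}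
    (hF : DifferentiableAt ℝ F e) (hA : DifferentiableAt ℝ A e) :
    extDeriv (fun e => F e • A e) e
      = wedgeAlt (ContinuousAlternatingMap.ofSubsingleton ℝ E ℂ (0 : Fin 1) (fderiv ℝ F e)) (A e)
        + F e • extDeriv A e := by
  rw [extDeriv, fderiv_fun_smul hF hA, ContinuousAlternatingMap.alternatizeUncurryFin_add,
    add_comm (ContinuousAlternatingMap.alternatizeUncurryFin _)]
  refine congrArg₂ (· + ·) ?_ (ContinuousAlternatingMap.alternatizeUncurryFin_smul _ _)
  rw [wedgeAlt, Equiv.symm_apply_apply]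

theorem wedgeAlt_compContinuousLinearMap (α : E' [⋀^Fin 1]→L[ℝ] ℂ) (φ : E' [⋀^Fin p]→L[ℝ] ℂ)
    (L : E →L[ℝ] E') :
    (wedgeAlt α φ).compContinuousLinearMap L
      = wedgeAlt (α.compContinuousLinearMap L) (φ.compContinuousLinearMap L) := by
  ext v
  simp only [wedgeAlt, ContinuousAlternatingMap.compContinuousLinearMap_apply,
    ContinuousAlternatingMap.alternatizeUncurryFin_apply]
  rfl

/-- The Leibniz rule in the chart at `x` is pulled back along that chart. The auxiliary facts `hφ'`
and `hf'` say that passing to coordinates and back returns φ and df at `x`. -/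
theorem extD_fsmul {f : M → ℂ} {φ : DForm E M p} {x : M}
    (hf : ContMDiffAt 𝓘(ℝ, E) 𝓘(ℝ, ℂ) ∞ f x) (hφ : SmoothFormAt φ x) :
    (extD (fsmul f φ)).val x
      = wedgeAlt ((dFun f : DForm E M 1).val x) (φ.val x) + f x • (extD φ).val x := by
  have hF := contDiffAt_comp_extChartAt_symm hf
  have hx := extChartAt_to_inv (I := 𝓘(ℝ, E)) x

  have hφ' : (inChart x φ (extChartAt 𝓘(ℝ, E) x x)).compContinuousLinearMap
      (tangentMapAt E E (extChartAt 𝓘(ℝ, E) x) x) = φ.val x := by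
    have h1 : inChart x φ (extChartAt 𝓘(ℝ, E) x x)
        = (φ.val x).compContinuousLinearMap
          (tangentMapAt E E (extChartAt 𝓘(ℝ, E) x).symm (extChartAt 𝓘(ℝ, E) x x)) := by
      have h2 : φ.val ((extChartAt 𝓘(ℝ, E) x).symm (extChartAt 𝓘(ℝ, E) x x)) = φ.val x := by
        rw [hx]
      rw [← h2]
      rfl
    rw [h1]
    exact congrArg (ContinuousAlternatingMap.compContinuousLinearMap (φ.val x))
      (tangentMapAt_extChartAt_symm_comp x)
  have hf' : (ContinuousAlternatingMap.ofSubsingleton ℝ E ℂ (0 : Fin 1)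
      (fderiv ℝ (fun e => f ((extChartAt 𝓘(ℝ, E) x).symm e))
        (extChartAt 𝓘(ℝ, E) x x))).compContinuousLinearMap
      (tangentMapAt E E (extChartAt 𝓘(ℝ, E) x) x) = (dFun f : DForm E M 1).val x := by
    have h1 : tangentMapAt E ℂ ((fun e => f ((extChartAt 𝓘(ℝ, E) x).symm e)) ∘
        extChartAt 𝓘(ℝ, E) x) x = _ :=
      mfderiv_comp x (hF.contMDiffAt.mdifferentiableAt (by simp))
        ((contMDiffAt_extChartAt_of_mem_source
          (mem_extChartAt_source x)).mdifferentiableAt (by simp))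
    have h2 : (fun e => f ((extChartAt 𝓘(ℝ, E) x).symm e)) ∘ extChartAt 𝓘(ℝ, E) x =ᶠ[𝓝 x] f := by
      filter_upwards [extChartAt_source_mem_nhds (I := 𝓘(ℝ, E)) x] with y hy
      exact congrArg f ((extChartAt 𝓘(ℝ, E) x).left_inv hy)
    have h3 : tangentMapAt E ℂ f x = (fderiv ℝ (fun e => f ((extChartAt 𝓘(ℝ, E) x).symm e))
        (extChartAt 𝓘(ℝ, E) x x)).comp (tangentMapAt E E (extChartAt 𝓘(ℝ, E) x) x) := by
      have h4 : tangentMapAt E ℂ ((fun e => f ((extChartAt 𝓘(ℝ, E) x).symm e)) ∘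
        extChartAt 𝓘(ℝ, E) x) x = tangentMapAt E ℂ f x := h2.mfderiv_eq
      rw [← h4, h1, ← mfderiv_eq_fderiv]
      rfl
    have h5 : (dFun f : DForm E M 1).val x
      = ContinuousAlternatingMap.ofSubsingleton ℝ E ℂ (0 : Fin 1) (tangentMapAt E ℂ f x) := rfl
    rw [h5, h3]
    rfl
  rw [extD_val, inChart_fsmul, extDeriv_function_smul (hF.differentiableAt (by simp))
    (ContDiffAt.differentiableAt hφ (by simp)), hx, extD_val, ← hφ', ← hf',
    ← wedgeAlt_compContinuousLinearMap]
  rfl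

end Smooth

end Calculus

/-! ### Branches of the twist. -/

section Branches

variable {E : Type*} [NormedAddCommGroup E] [NormedSpace ℝ E]
  {M : Type*} [TopologicalSpace M] [ChartedSpace E M]
  {E' : Type*} [NormedAddCommGroup E'] [NormedSpace ℝ E']
  {M' : Type*} [TopologicalSpace M'] [ChartedSpace E' M'] {p : ℕ}

theorem wedgeAlt_smul_left (a : ℂ) (α : E [⋀^Fin 1]→L[ℝ] ℂ) (φ : E [⋀^Fin p]→L[ℝ] ℂ) :
    wedgeAlt (a • α) φ = a • wedgeAlt α φ := by
  ext v
  simp only [wedgeAlt, ContinuousAlternatingMap.alternatizeUncurryFin_apply,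
    ContinuousLinearMap.smulRight_apply, ContinuousAlternatingMap.smul_apply, Finset.smul_sum]
  refine Finset.sum_congr rfl fun j _ => ?_
  rw [smul_comm a, ← smul_assoc a]
  rfl

theorem wedgeAlt_zero_left (φ : E [⋀^Fin p]→L[ℝ] ℂ) : wedgeAlt 0 φ = 0 := by
  ext v
  simp [wedgeAlt, ContinuousAlternatingMap.alternatizeUncurryFin_apply]

theorem dFun_val (f : M → ℂ) (x : M) : (dFun f : DForm E M 1).val x
    = ContinuousAlternatingMap.ofSubsingleton ℝ E ℂ (0 : Fin 1) (tangentMapAt E ℂ f x) := rfl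

theorem dFun_val_congr {f g : M → ℂ} {x : M} (h : f =ᶠ[𝓝 x] g) :
    (dFun f : DForm E M 1).val x = (dFun g : DForm E M 1).val x := by
  have h1 : tangentMapAt E ℂ f x = tangentMapAt E ℂ g x := h.mfderiv_eq
  rw [dFun_val, dFun_val, h1]

theorem dFun_const (a : ℂ) (x : M) : (dFun (fun _ => a) : DForm E M 1).val x = 0 := by
  have h1 : tangentMapAt E ℂ (fun _ : M => a) x = 0 := mfderiv_const
  rw [dFun_val, h1]
  rfl

theorem dFun_comp_val {v : M' → ℂ} {f : M → M'} {x : M}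
    (hv : MDifferentiableAt 𝓘(ℝ, E') 𝓘(ℝ, ℂ) v (f x))
    (hf : MDifferentiableAt 𝓘(ℝ, E) 𝓘(ℝ, E') f x) :
    (dFun (v ∘ f) : DForm E M 1).val x = (pullback (E := E) f (dFun v : DForm E' M' 1)).val x := by
  have h1 : tangentMapAt E ℂ (v ∘ f) x
      = (tangentMapAt E' ℂ v (f x)).comp (tangentMapAt E E' f x) := mfderiv_comp x hv hf
  rw [dFun_val, h1]
  rfl

theorem covD_val (ω₀ : DForm E M 1) (φ : DForm E M p) (x : M) :
    (covD ω₀ φ).val x = (extD φ).val x - wedgeAlt (ω₀.val x) (φ.val x) := rfl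

theorem covD_val_congr (ω₀ : DForm E M 1) {φ ψ : DForm E M p} {x : M}
    (h : ∀ᶠ y in 𝓝 x, φ.val y = ψ.val y) : (covD ω₀ φ).val x = (covD ω₀ ψ).val x := by
  rw [covD_val, covD_val, extD_val_congr h, h.self_of_nhds]

theorem IsBranch.contMDiffAt {ω₀ : DForm E M 1} {V : Set M} {v : M → ℂ} (h : IsBranch ω₀ V v)
    {x : M} (hx : x ∈ V) : ContMDiffAt 𝓘(ℝ, E) 𝓘(ℝ, ℂ) ∞ v x :=
  h.smooth.contMDiffAt (h.isOpen.mem_nhds hx)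

theorem IsBranch.mono {ω₀ : DForm E M 1} {V W : Set M} {v : M → ℂ} (h : IsBranch ω₀ V v)
    (hW : IsOpen W) (hWV : W ⊆ V) : IsBranch ω₀ W v :=
  ⟨hW, h.smooth.mono hWV, fun y hy => h.ne_zero y (hWV hy), fun y hy => h.dlog y (hWV hy)⟩

theorem IsBranch.pullback {ω₀ : DForm E' M' 1} {V : Set M'} {v : M' → ℂ} (h : IsBranch ω₀ V v)
    {f : M → M'} {S : Set M} (hS : IsOpen S)
    (hf : ∀ x ∈ S, ContMDiffAt 𝓘(ℝ, E) 𝓘(ℝ, E') ∞ f x) (hfS : Set.MapsTo f S V) :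
    IsBranch (Leray.pullback (E := E) f ω₀) S (v ∘ f) where
  isOpen := hS
  smooth x hx := ((h.contMDiffAt (hfS hx)).comp x (hf x hx)).contMDiffWithinAt
  ne_zero x hx := h.ne_zero _ (hfS hx)
  dlog x hx := by
    have h1 := dFun_comp_val ((h.contMDiffAt (hfS hx)).mdifferentiableAt (by simp))
      ((hf x hx).mdifferentiableAt (by simp))
    have h2 : (dFun v : DForm E' M' 1).val (f x) = v (f x) • ω₀.val (f x) := h.dlog _ (hfS hx)
    rw [pullback_val, h2] at h1
    exact h1

/-- With a branch `v` of the twist, `∇(v φ) = v dφ`. -/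
theorem IsBranch.covD_fsmul [IsManifold 𝓘(ℝ, E) ∞ M] {ω₀ : DForm E M 1} {V : Set M} {v : M → ℂ}
    (h : IsBranch ω₀ V v) {φ : DForm E M p} {x : M} (hx : x ∈ V) (hφ : SmoothFormAt φ x) :
    (covD ω₀ (fsmul v φ)).val x = v x • (extD φ).val x := by
  have h1 : (dFun v : DForm E M 1).val x = v x • ω₀.val x := h.dlog x hx
  have h2 : (fsmul v φ).val x = v x • φ.val x := rfl
  rw [covD_val, extD_fsmul (h.contMDiffAt hx) hφ, h1, h2, wedgeAlt_smul, wedgeAlt_smul_left,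
    add_sub_cancel_left]

/-! ### Branches on convex open subsets of a vector space. -/

section VectorSpace

variable {G : Type*} [NormedAddCommGroup G] [NormedSpace ℝ G]

theorem inChart_vectorSpace (c : G) (φ : DForm G G p) : inChart c φ = φ.val := by
  funext e
  have h : inChart c φ = pullback (E := G) id φ := by
    rw [inChart_eq_pullback, extChartAt_model_space_eq_id]
    rfl
  rw [h]
  exact pullback_id_val φ e

theorem smoothFormAt_vectorSpace {φ : DForm G G p} {x : G} :
    SmoothFormAt φ x ↔ ContDiffAt ℝ ∞ φ.val x := by
  rw [SmoothFormAt, inChart_vectorSpace]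
  rfl

theorem extD_vectorSpace (φ : DForm G G p) (x : G) : (extD φ).val x = extDeriv φ.val x := by
  have h1 : tangentMapAt G G (extChartAt 𝓘(ℝ, G) x) x = ContinuousLinearMap.id ℝ G := by
    rw [extChartAt_model_space_eq_id]
    exact mfderiv_id
  rw [extD_val, inChart_vectorSpace, h1]
  rfl

variable (G) in
/-- An alternating `1`-form as a linear form. -/
def linearFormOfAlt : (G [⋀^Fin 1]→L[ℝ] ℂ) →L[ℝ] (G →L[ℝ] ℂ) :=
  LinearMap.mkContinuous
    { toFun := (ContinuousAlternatingMap.ofSubsingleton ℝ G ℂ (0 : Fin 1)).symm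
      map_add' := fun _ _ => rfl
      map_smul' := fun _ _ => rfl } 1 fun φ => by
    rw [one_mul]
    exact ContinuousLinearMap.opNorm_le_bound _ (norm_nonneg _) fun v => by
      have h := φ.le_opNorm fun _ => v
      rw [Fin.prod_univ_one] at h
      exact h

theorem linearFormOfAlt_apply (φ : G [⋀^Fin 1]→L[ℝ] ℂ) (w : G) :
    linearFormOfAlt G φ w = φ fun _ => w := rfl

theorem linearFormOfAlt_ofSubsingleton (L : G →L[ℝ] ℂ) :
    linearFormOfAlt G (ContinuousAlternatingMap.ofSubsingleton ℝ G ℂ (0 : Fin 1) L) = L := rfl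

theorem ofSubsingleton_linearFormOfAlt (φ : G [⋀^Fin 1]→L[ℝ] ℂ) :
    ContinuousAlternatingMap.ofSubsingleton ℝ G ℂ (0 : Fin 1) (linearFormOfAlt G φ) = φ :=
  Equiv.apply_symm_apply _ _

/-- The Poincaré lemma for smooth `1`-forms on convex open sets. -/
theorem exists_primitive_of_convex {C : Set G} (hC : Convex ℝ C) (hCo : IsOpen C)
    {ξ : DForm G G 1} (hξ : ∀ a ∈ C, SmoothFormAt ξ a) (hd : ∀ a ∈ C, (extD ξ).val a = 0) :
    ∃ g : G → ℂ, ContDiffOn ℝ ∞ g C ∧ ∀ a ∈ C, (dFun g : DForm G G 1).val a = ξ.val a := by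
  have hξs : ∀ a ∈ C, ContDiffAt ℝ ∞ ξ.val a := fun a ha => smoothFormAt_vectorSpace.1 (hξ a ha)
  have hω : ∀ a ∈ C, ContDiffAt ℝ ∞ (fun x => linearFormOfAlt G (ξ.val x)) a := fun a ha =>
    (linearFormOfAlt G).contDiff.contDiffAt.comp a (hξs a ha)
  have hωd : DifferentiableOn ℝ (fun x => linearFormOfAlt G (ξ.val x)) C := fun a ha =>
    ((hω a ha).differentiableAt (by simp)).differentiableWithinAt
  obtain ⟨g, hg⟩ := hC.exists_forall_hasFDerivAt_of_fderiv_symmetric hCo hωd (by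
      intro a ha x y
      have hda : DifferentiableAt ℝ ξ.val a := (hξs a ha).differentiableAt (by simp)
      have h1 : fderiv ℝ (fun x => linearFormOfAlt G (ξ.val x)) a
          = (linearFormOfAlt G).comp (fderiv ℝ ξ.val a) :=
        ((linearFormOfAlt G).hasFDerivAt.comp a hda.hasFDerivAt).fderiv
      have h2 := hd a ha
      rw [extD_vectorSpace] at h2
      -- Evaluated on a pair of vectors, dξ = 0 says exactly that the derivative of ξ is symmetric,
      -- the hypothesis of the convex primitive theorem.
      have h3 := congrArg (fun A : G [⋀^Fin 2]→L[ℝ] ℂ => A ![x, y]) h2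
      simp only [extDeriv, ContinuousAlternatingMap.alternatizeUncurryFin_apply] at h3
      replace h3 := (Fin.sum_univ_two _).symm.trans h3
      have h4 : (0 : Fin 2).removeNth ![x, y] = fun _ : Fin 1 => y := by
        funext j; fin_cases j; rfl
      have h5 : (1 : Fin 2).removeNth ![x, y] = fun _ : Fin 1 => x := by
        funext j; fin_cases j; rfl
      rw [h1]
      simp only [ContinuousLinearMap.comp_apply, linearFormOfAlt_apply]
      change _ • fderiv ℝ ξ.val a x _ + _ • fderiv ℝ ξ.val a y _ = _ at h3
      rw [h4, h5] at h3
      simp at h3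
      linear_combination h3)
  refine ⟨g, ?_, fun a ha => ?_⟩
  · refine (contDiffOn_infty_iff_fderiv_of_isOpen hCo).2
      ⟨fun a ha => (hg a ha).differentiableAt.differentiableWithinAt, ?_⟩
    refine ContDiffOn.congr (f := fun x => linearFormOfAlt G (ξ.val x))
      (fun a ha => (hω a ha).contDiffWithinAt) fun a ha => (hg a ha).fderiv
  · have h1 : tangentMapAt G ℂ g a = fderiv ℝ g a := mfderiv_eq_fderiv
    rw [dFun_val, h1, (hg a ha).fderiv, ofSubsingleton_linearFormOfAlt]

theorem isBranch_exp {C : Set G} (hCo : IsOpen C) {ξ : DForm G G 1} {g : G → ℂ}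
    (hg : ContDiffOn ℝ ∞ g C) (hξ : ∀ a ∈ C, (dFun g : DForm G G 1).val a = ξ.val a) :
    IsBranch ξ C fun a => Complex.exp (g a) where
  isOpen := hCo
  smooth := contMDiffOn_iff_contDiffOn.2 hg.cexp
  ne_zero a _ := Complex.exp_ne_zero _
  dlog a ha := by
    have hga : HasFDerivAt g (fderiv ℝ g a) a :=
      ((hg.contDiffAt (hCo.mem_nhds ha)).differentiableAt (by simp)).hasFDerivAt
    have h1 : tangentMapAt G ℂ g a = fderiv ℝ g a := mfderiv_eq_fderiv
    have h2 : tangentMapAt G ℂ (fun a => Complex.exp (g a)) a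
        = Complex.exp (g a) • fderiv ℝ g a := mfderiv_eq_fderiv.trans hga.cexp.fderiv
    have h3 : (dFun (fun a => Complex.exp (g a)) : DForm G G 1).val a
        = Complex.exp (g a) • ξ.val a := by
      rw [← hξ a ha, dFun_val, dFun_val, h2, h1]
      rfl
    exact h3

theorem IsBranch.hasFDerivAt {C : Set G} {ξ : DForm G G 1} {v : G → ℂ} (h : IsBranch ξ C v)
    {a : G} (ha : a ∈ C) : HasFDerivAt v (v a • linearFormOfAlt G (ξ.val a)) a := by
  have hd : DifferentiableAt ℝ v a :=
    (contMDiffAt_iff_contDiffAt.1 (h.contMDiffAt ha)).differentiableAt (by simp)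
  have h1 : tangentMapAt G ℂ v a = fderiv ℝ v a := mfderiv_eq_fderiv
  have h2 : (dFun v : DForm G G 1).val a = v a • ξ.val a := h.dlog a ha
  have h3 : fderiv ℝ v a = v a • linearFormOfAlt G (ξ.val a) := by
    rw [← h1, ← linearFormOfAlt_ofSubsingleton (tangentMapAt G ℂ v a), ← dFun_val, h2]
    rfl
  exact h3 ▸ hd.hasFDerivAt

/-- Two branches of the same twist on a convex open set have constant ratio. -/
theorem IsBranch.div_eq_div {C : Set G} (hC : Convex ℝ C) {ξ : DForm G G 1} {v w : G → ℂ}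
    (hv : IsBranch ξ C v) (hw : IsBranch ξ C w) {a b : G} (ha : a ∈ C) (hb : b ∈ C) :
    v a / v b = w a / w b := by
  -- Both branches have logarithmic derivative ξ, so it cancels in the quotient.
  have hq : ∀ c ∈ C, HasFDerivAt (fun c => v c * (w c)⁻¹) (0 : G →L[ℝ] ℂ) c := by
    intro c hc
    have h1 := (hv.hasFDerivAt hc).mul ((hasDerivAt_inv (hw.ne_zero c hc)).comp_hasFDerivAt_of_eq
      c (hw.hasFDerivAt hc) rfl)
    refine h1.congr_fderiv ?_
    ext z
    have := hw.ne_zero c hc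
    simp
    field_simp
    ring
  have h := hv.isOpen.is_const_of_fderiv_eq_zero (𝕜 := ℝ) hC.isPreconnected
    (fun c hc => (hq c hc).differentiableAt.differentiableWithinAt)
    (fun c hc => (hq c hc).fderiv) ha hb
  have h1 := hv.ne_zero b hb
  have h2 := hw.ne_zero a ha
  have h3 := hw.ne_zero b hb
  change v a * (w a)⁻¹ = v b * (w b)⁻¹ at h
  field_simp at h ⊢
  linear_combination h

end VectorSpace

/-- A closed `1`-form has a branch on any open set diffeomorphic to a convex one. -/
theorem exists_isBranch_of_convex {G : Type*} [NormedAddCommGroup G] [NormedSpace ℝ G]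
    [FiniteDimensional ℝ G] [IsManifold 𝓘(ℝ, E) ∞ M] {ω₀ : DForm E M 1}
    (hω : ∀ x, SmoothFormAt ω₀ x) (hdω : extD ω₀ = 0) {C : Set G} (hC : Convex ℝ C)
    (hCo : IsOpen C) {V : Set M} (hV : IsOpen V) {s : G → M} {r : M → G}
    (hs : ∀ a ∈ C, ContMDiffAt 𝓘(ℝ, G) 𝓘(ℝ, E) ∞ s a)
    (hr : ∀ y ∈ V, ContMDiffAt 𝓘(ℝ, E) 𝓘(ℝ, G) ∞ r y) (hrV : Set.MapsTo r V C)
    (hsr : ∀ y ∈ V, s (r y) = y) : ∃ v, IsBranch ω₀ V v := by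
  -- The branch is `exp g ∘ r`, where `g` is a primitive of `s^*ω₀`; its twist `r^* s^* ω₀` is ω₀ on
  -- `V` because `s ∘ r` is the identity there.
  obtain ⟨g, hg, hgd⟩ := exists_primitive_of_convex hC hCo (ξ := pullback (E := G) s ω₀)
    (fun a ha => (hω _).pullback (hs a ha)) (fun a ha => by
      rw [extD_pullback (hω _) (hs a ha), hdω]
      rfl)
  have hb := (isBranch_exp hCo hg hgd).pullback (E := E) (M := M) hV hr hrV
  refine ⟨_, hV, hb.smooth, hb.ne_zero, fun y hy => ?_⟩
  have hy' : s ∘ r =ᶠ[𝓝 y] id := by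
    filter_upwards [hV.mem_nhds hy] with z hz using hsr z hz
  have h1 : (pullback (E := E) r (pullback (E := G) s ω₀)).val y = ω₀.val y := by
    rw [← pullback_comp_val ((hs _ (hrV hy)).mdifferentiableAt (by simp))
      ((hr y hy).mdifferentiableAt (by simp)), pullback_val_congr hy', pullback_id_val]
  exact (hb.dlog y hy).trans (congrArg _ h1)

end Branches

/-! ### The ratio u/(u∘π) and the form u π^*(ψ/u) on the tube. -/

section TwistRatio

variable {E : Type*} [NormedAddCommGroup E] [NormedSpace ℝ E]
  {Y : Type*} [TopologicalSpace Y] [ChartedSpace E Y]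
  {E' : Type*} [NormedAddCommGroup E'] [NormedSpace ℝ E']
  {D : Type*} [TopologicalSpace D] [ChartedSpace E' D]
  {F : Type*} [NormedAddCommGroup F] [NormedSpace ℝ F]
  {i : D → Y} {U : Set Y} {π : Y → D} {ω₀ : DForm E Y 1} {p : ℕ}

theorem IsTubularNeighbourhood.contMDiffAt_proj (hU : IsTubularNeighbourhood E E' F i U π) {y : Y}
    (hy : y ∈ U) : ContMDiffAt 𝓘(ℝ, E) 𝓘(ℝ, E') ∞ π y :=
  hU.smooth_proj.contMDiffAt (hU.isOpen.mem_nhds hy)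

theorem IsTubularNeighbourhood.isOpen_preimage (hU : IsTubularNeighbourhood E E' F i U π)
    {B : Set D} (hB : IsOpen B) : IsOpen (U ∩ π ⁻¹' B) :=
  hU.smooth_proj.continuousOn.isOpen_inter_preimage hU.isOpen hB

/-- Near every fibre of the tube the twist has a branch. -/
theorem IsTubularNeighbourhood.exists_isBranch [FiniteDimensional ℝ E] [FiniteDimensional ℝ E']
    [FiniteDimensional ℝ F] [IsManifold 𝓘(ℝ, E) ∞ Y] [IsManifold 𝓘(ℝ, E') ∞ D]
    (hU : IsTubularNeighbourhood E E' F i U π) (hω : ω₀ ∈ smoothForms E Y 1) (hdω : extD ω₀ = 0)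
    (x₀ : D) : ∃ B : Set D, IsOpen B ∧ x₀ ∈ B ∧ ∃ v, IsBranch ω₀ (U ∩ π ⁻¹' B) v := by
  obtain ⟨W, hW, hx₀, e, hes, het, hesm, hesymm, he1, -⟩ := hU.locally_trivial x₀
  set c := extChartAt 𝓘(ℝ, E') x₀ with hc
  have hx₀s : x₀ ∈ c.source := mem_extChartAt_source x₀
  have hO : IsOpen (c.target ∩ c.symm ⁻¹' W) :=
    (continuousOn_extChartAt_symm x₀).isOpen_inter_preimage (isOpen_extChartAt_target x₀) hW
  -- The coordinate ball must lie over the trivialising set `W`, so that the tube above it is a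
  -- product of two balls, hence convex in coordinates.
  obtain ⟨ε, hε, hball⟩ := Metric.isOpen_iff.1 hO (c x₀)
    ⟨c.map_source hx₀s, by rw [Set.mem_preimage, c.left_inv hx₀s]; exact hx₀⟩
  have hBo : IsOpen (W ∩ (c.source ∩ c ⁻¹' Metric.ball (c x₀) ε)) :=
    hW.inter ((continuousOn_extChartAt x₀).isOpen_inter_preimage (isOpen_extChartAt_source x₀)
      Metric.isOpen_ball)
  refine ⟨_, hBo, ⟨hx₀, hx₀s, Metric.mem_ball_self hε⟩, ?_⟩
  have heto : IsOpen e.target := e.open_target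
  refine exists_isBranch_of_convex (G := E' × F)
    (C := Metric.ball (c x₀) ε ×ˢ Metric.ball (0 : F) 1)
    (s := fun a => e.symm (c.symm a.1, a.2)) (r := fun y => (c (π y), (e y).2))
    (mem_smoothForms_iff.1 hω) hdω ((convex_ball _ _).prod (convex_ball _ _))
    (Metric.isOpen_ball.prod Metric.isOpen_ball) (hU.isOpen_preimage hBo) ?_ ?_ ?_ ?_
  · rintro ⟨a, b⟩ ⟨ha, hb⟩
    have ht : (c.symm a, b) ∈ e.target := by
      rw [het]
      exact ⟨(hball ha).2, hb⟩
    have h1 : ContMDiffAt 𝓘(ℝ, E' × F) 𝓘(ℝ, E') ∞ (fun a : E' × F => c.symm a.1) (a, b) :=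
      ContMDiffAt.comp (a, b) (contMDiffAt_extChartAt_symm' (hball ha).1)
        contDiff_fst.contMDiff.contMDiffAt
    have h2 : ContMDiffAt 𝓘(ℝ, E' × F) 𝓘(ℝ, F) ∞ (fun a : E' × F => a.2) (a, b) :=
      contDiff_snd.contMDiff.contMDiffAt
    exact ContMDiffAt.comp (a, b) (hesymm.contMDiffAt (heto.mem_nhds ht)) (h1.prodMk h2)
  · rintro y ⟨hyU, hyW, hys, -⟩
    have hye : y ∈ e.source := by rw [hes]; exact ⟨hyU, hyW⟩
    have h1 : ContMDiffAt 𝓘(ℝ, E) 𝓘(ℝ, E') ∞ (fun y => c (π y)) y :=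
      (contMDiffAt_extChartAt_of_mem_source hys).comp y (hU.contMDiffAt_proj hyU)
    have h2 : ContMDiffAt 𝓘(ℝ, E) 𝓘(ℝ, F) ∞ (fun y => (e y).2) y :=
      contMDiffAt_snd.comp y (hesm.contMDiffAt (e.open_source.mem_nhds hye))
    exact h1.prodMk_space h2
  · rintro y ⟨hyU, hyW, hys, hyb⟩
    have hye : y ∈ e.source := by rw [hes]; exact ⟨hyU, hyW⟩
    have h := e.map_source hye
    rw [het] at h
    exact ⟨hyb, h.2⟩
  · rintro y ⟨hyU, hyW, hys, hyb⟩
    have hye : y ∈ e.source := by rw [hes]; exact ⟨hyU, hyW⟩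
    have h : (c.symm (c (π y)), (e y).2) = e y := by
      rw [c.left_inv hys, ← he1 y hye]
    change e.symm (c.symm (c (π y)), (e y).2) = y
    rw [h, e.left_inv hye]

/-- Both branches are restricted to the fibre through `y`, parametrised by the unit ball of `F`.
There they are branches of the same pulled-back form on a convex set, so their ratio is constant.
The two points compared are `(e y).2` and the centre 0, which is `i (π y)`. -/
theorem IsTubularNeighbourhood.ratio_eq_ratio (hU : IsTubularNeighbourhood E E' F i U π)
    {V V' : Set Y} {v v' : Y → ℂ} (hv : IsBranch ω₀ V v) (hv' : IsBranch ω₀ V' v') {y : Y}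
    (hy : y ∈ U) (hV : U ∩ π ⁻¹' {π y} ⊆ V) (hV' : U ∩ π ⁻¹' {π y} ⊆ V') :
    v y / v (i (π y)) = v' y / v' (i (π y)) := by
  obtain ⟨W, hW, hx₀, e, hes, het, hesm, hesymm, he1, he0⟩ := hU.locally_trivial (π y)
  have hye : y ∈ e.source := by rw [hes]; exact ⟨hy, hx₀⟩
  have hie : i (π y) ∈ e.source := by
    rw [hes]; exact ⟨hU.incl_mem _, by rw [Set.mem_preimage, hU.proj_incl]; exact hx₀⟩
  have ht : ∀ b ∈ Metric.ball (0 : F) 1, (π y, b) ∈ e.target := fun b hb => by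
    rw [het]; exact ⟨hx₀, hb⟩
  have hk : ∀ b ∈ Metric.ball (0 : F) 1,
      ContMDiffAt 𝓘(ℝ, F) 𝓘(ℝ, E) ∞ (fun b => e.symm (π y, b)) b := fun b hb =>
    ContMDiffAt.comp b (hesymm.contMDiffAt (e.open_target.mem_nhds (ht b hb)))
      (contMDiffAt_const.prodMk contMDiffAt_id)
  have hkf : Set.MapsTo (fun b => e.symm (π y, b)) (Metric.ball (0 : F) 1)
      (U ∩ π ⁻¹' {π y}) := fun b hb => by
    have h1 := e.map_target (ht b hb)
    refine ⟨(hes ▸ h1 : _ ∈ U ∩ π ⁻¹' W).1, ?_⟩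
    change π (e.symm (π y, b)) = π y
    rw [← he1 _ h1, e.right_inv (ht b hb)]
  have hb : (e y).2 ∈ Metric.ball (0 : F) 1 := by
    have h := e.map_source hye
    rw [het] at h
    exact h.2
  have h := (hv.pullback Metric.isOpen_ball hk (hkf.mono_right hV)).div_eq_div (convex_ball _ _)
    (hv'.pullback Metric.isOpen_ball hk (hkf.mono_right hV')) hb (Metric.mem_ball_self one_pos)
  have h1 : e.symm (π y, (e y).2) = y := by
    have h2 : (π y, (e y).2) = e y := by rw [← he1 y hye]
    rw [h2, e.left_inv hye]
  have h0 : e.symm (π y, 0) = i (π y) := by rw [← he0 _ hx₀, e.left_inv hie]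
  simpa only [Function.comp_apply, h1, h0] using h

/-- The value chosen by `Classical.epsilon` comes from some unknown branch; independence of the
branch lets any convenient one replace it. -/
theorem IsTubularNeighbourhood.twistRatio_eq (hU : IsTubularNeighbourhood E E' F i U π)
    {V : Set Y} {v : Y → ℂ} (hv : IsBranch ω₀ V v) {y : Y} (hy : y ∈ U)
    (hV : U ∩ π ⁻¹' {π y} ⊆ V) : twistRatio ω₀ i U π y = v y / v (i (π y)) := by
  rw [twistRatio, Set.indicator_of_mem hy]
  obtain ⟨V', v', hv', hV', hz⟩ : IsTwistRatio ω₀ i U π y _ :=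
    Classical.epsilon_spec ⟨_, V, v, hv, hV, rfl⟩
  exact hz.trans (hU.ratio_eq_ratio hv' hv hy hV' hV)

theorem IsTubularNeighbourhood.existsUnique_isTwistRatio [FiniteDimensional ℝ E]
    [FiniteDimensional ℝ E'] [FiniteDimensional ℝ F] [IsManifold 𝓘(ℝ, E) ∞ Y]
    [IsManifold 𝓘(ℝ, E') ∞ D] (hU : IsTubularNeighbourhood E E' F i U π)
    (hω : ω₀ ∈ smoothForms E Y 1) (hdω : extD ω₀ = 0) {y : Y} (hy : y ∈ U) :
    ∃! z, IsTwistRatio ω₀ i U π y z := by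
  obtain ⟨B, hB, hyB, v, hv⟩ := hU.exists_isBranch hω hdω (π y)
  have hV : U ∩ π ⁻¹' {π y} ⊆ U ∩ π ⁻¹' B := fun z hz =>
    ⟨hz.1, by rw [Set.mem_preimage, show π z = π y from hz.2]; exact hyB⟩
  refine ⟨_, ⟨_, v, hv, hV, rfl⟩, ?_⟩
  rintro _ ⟨V', v', hv', hV', rfl⟩
  exact hU.ratio_eq_ratio hv' hv hy hV' hV

/-- Near every point of the tube, `u π^*(ψ / u)` is a branch of the twist times a closed form. -/
theorem IsTubularNeighbourhood.exists_twistPullback_eq [FiniteDimensional ℝ E]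
    [FiniteDimensional ℝ E'] [FiniteDimensional ℝ F] [IsManifold 𝓘(ℝ, E) ∞ Y]
    [IsManifold 𝓘(ℝ, E') ∞ D] (hU : IsTubularNeighbourhood E E' F i U π)
    (hi : ContMDiff 𝓘(ℝ, E') 𝓘(ℝ, E) ∞ i)
    (hω : ω₀ ∈ smoothForms E Y 1) (hdω : extD ω₀ = 0) {ψ : DForm E' D p}
    (hψ : ψ ∈ smoothForms E' D p) (hdψ : covD (pullback (E := E') i ω₀) ψ = 0) {y : Y}
    (hy : y ∈ U) :
    ∃ (V : Set Y) (v : Y → ℂ) (β : DForm E Y p), y ∈ V ∧ IsBranch ω₀ V v ∧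
      (∀ z ∈ V, (twistPullback ω₀ i U π ψ).val z = (fsmul v β).val z) ∧
      ∀ z ∈ V, SmoothFormAt β z ∧ (extD β).val z = 0 := by
  obtain ⟨B, hB, hyB, v, hv⟩ := hU.exists_isBranch hω hdω (π y)
  rw [mem_smoothForms_iff] at hψ
  have hiB : Set.MapsTo i B (U ∩ π ⁻¹' B) := fun x hx =>
    ⟨hU.incl_mem x, by rw [Set.mem_preimage, hU.proj_incl]; exact hx⟩
  have hvi := hv.pullback hB (fun x _ => hi x) hiB
  -- This is ψ/u on D for the chosen branch. Since `v ∘ i` is a branch of the restricted twist, ∇ψ =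
  -- 0 becomes (v∘i) dχ = 0, so χ is closed.
  set χ : DForm E' D p := fsmul (fun x => ((v ∘ i) x)⁻¹) ψ with hχ
  have hχs : ∀ x ∈ B, SmoothFormAt χ x := fun x hx => by
    refine SmoothFormAt.fsmul ?_ (hψ x)
    have h1 : ContDiffAt ℝ ∞ (fun z : ℂ => z⁻¹) ((v ∘ i) x) :=
      contDiffAt_inv ℝ (hvi.ne_zero x hx)
    exact h1.contMDiffAt.comp x (hvi.contMDiffAt hx)
  have hψχ : ∀ x ∈ B, ψ.val x = (fsmul (v ∘ i) χ).val x := fun x hx => by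
    have h1 : (fsmul (v ∘ i) χ).val x = (v ∘ i) x • ((v ∘ i) x)⁻¹ • ψ.val x := rfl
    rw [h1, smul_inv_smul₀ (hvi.ne_zero x hx)]
  have hχd : ∀ x ∈ B, (extD χ).val x = 0 := fun x hx => by
    have h1 : (covD (pullback (E := E') i ω₀) ψ).val x = 0 := by rw [hdψ]; rfl
    rw [covD_val_congr _ (by filter_upwards [hB.mem_nhds hx] using hψχ),
      hvi.covD_fsmul hx (hχs x hx)] at h1
    exact (smul_eq_zero.1 h1).resolve_left (hvi.ne_zero x hx)
  refine ⟨U ∩ π ⁻¹' B, v, pullback (E := E) π χ, ⟨hy, hyB⟩, hv, fun z hz => ?_,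
    fun z hz => ⟨?_, ?_⟩⟩
  · have h1 : U ∩ π ⁻¹' {π z} ⊆ U ∩ π ⁻¹' B := fun w hw =>
      ⟨hw.1, by rw [Set.mem_preimage, show π w = π z from hw.2]; exact hz.2⟩
    have h2 : (twistPullback ω₀ i U π ψ).val z
      = twistRatio ω₀ i U π z • (pullback (E := E) π ψ).val z := rfl
    rw [h2, hU.twistRatio_eq hv hz.1 h1, div_eq_mul_inv, mul_smul]
    rfl
  · exact (hχs _ hz.2).pullback (hU.contMDiffAt_proj hz.1)
  · rw [extD_pullback (hχs _ hz.2) (hU.contMDiffAt_proj hz.1), pullback_val, hχd _ hz.2]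
    rfl

end TwistRatio

/-! ### The Leray form and its primitive. -/

section LerayForm

variable {E : Type*} [NormedAddCommGroup E] [NormedSpace ℝ E]
  {Y : Type*} [TopologicalSpace Y] [ChartedSpace E Y]
  {E' : Type*} [NormedAddCommGroup E'] [NormedSpace ℝ E']
  {D : Type*} {F : Type*} [NormedAddCommGroup F] [NormedSpace ℝ F]
  {i : D → Y} {U N : Set Y} {θ : Y → ℝ}

theorem IsStep.eventually_eq_one (hθ : IsStep (E := E) i N U θ) {y : Y} (hy : y ∉ U) :
    ∀ᶠ z in 𝓝 y, θ z = 1 := by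
  filter_upwards [isClosed_closure.isOpen_compl.mem_nhds fun h => hy (hθ.closure_subset h)] with z hz
  by_contra h
  exact hz (subset_closure h)

theorem IsStep.contMDiff_ofReal (hθ : IsStep (E := E) i N U θ) :
    ContMDiff 𝓘(ℝ, E) 𝓘(ℝ, ℂ) ∞ fun y => (θ y : ℂ) :=
  Complex.ofRealCLM.contDiff.contMDiff.comp hθ.smooth

variable [TopologicalSpace D] [ChartedSpace E' D]
  {π : Y → D} {ω₀ : DForm E Y 1} {p : ℕ} {ψ : DForm E' D p}

theorem covD_zero (ω₀ : DForm E Y 1) : covD ω₀ (0 : DForm E Y p) = 0 :=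
  (nabla ω₀).map_zero

theorem alt_zero_smul (φ : E [⋀^Fin p]→L[ℝ] ℂ) : (0 : ℂ) • φ = 0 := by ext; simp

theorem alt_smul_zero (a : ℂ) : a • (0 : E [⋀^Fin p]→L[ℝ] ℂ) = 0 := by ext; simp

theorem alt_neg_one_smul (φ : E [⋀^Fin p]→L[ℝ] ℂ) : (-1 : ℂ) • φ = -φ := by ext; simp

theorem lerayForm_val (y : Y) : (lerayForm ω₀ i U π θ ψ).val y
    = wedgeAlt ((dFun (fun y => (θ y : ℂ)) : DForm E Y 1).val y)
      ((twistPullback ω₀ i U π ψ).val y) := rfl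

/-- dθ vanishes wherever θ is locally constant; used with `a = 0` on `N` and `a = 1` off `U`. -/
theorem lerayForm_val_eq_zero {a : ℝ} {y : Y} (h : ∀ᶠ z in 𝓝 y, θ z = a) :
    (lerayForm ω₀ i U π θ ψ).val y = 0 := by
  rw [lerayForm_val, dFun_val_congr (g := fun _ => (a : ℂ)) (by
    filter_upwards [h] with z hz using congrArg _ hz), dFun_const, wedgeAlt_zero_left]

theorem IsStep.lerayForm_eventually_eq_zero (hθ : IsStep (E := E) i N U θ) {y : Y} (hy : y ∉ U) :
    ∀ᶠ z in 𝓝 y, (lerayForm ω₀ i U π θ ψ).val z = (0 : DForm E Y (p + 1)).val z := by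
  filter_upwards [(hθ.eventually_eq_one hy).eventually_nhds] with z hz
  exact lerayForm_val_eq_zero hz

theorem IsStep.lerayPrimitive_eventually_eq_zero (hθ : IsStep (E := E) i N U θ) {y : Y}
    (hy : y ∉ U) :
    ∀ᶠ z in 𝓝 y, (lerayPrimitive ω₀ i U π θ ψ).val z = (0 : DForm E Y p).val z := by
  filter_upwards [hθ.eventually_eq_one hy] with z hz
  have h : (lerayPrimitive ω₀ i U π θ ψ).val z
    = ((θ z : ℂ) - 1) • (twistPullback ω₀ i U π ψ).val z := rfl
  rw [h, hz, Complex.ofReal_one, sub_self, alt_zero_smul]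
  rfl

theorem IsStep.lerayForm_eq_zero_of_mem (hθ : IsStep (E := E) i N U θ) {y : Y} (hy : y ∈ N) :
    (lerayForm ω₀ i U π θ ψ).val y = 0 :=
  lerayForm_val_eq_zero (by filter_upwards [hθ.isOpen.mem_nhds hy] using hθ.eq_zero)

theorem dFun_sub_const {f : Y → ℂ} (a : ℂ) {y : Y} (hf : MDifferentiableAt 𝓘(ℝ, E) 𝓘(ℝ, ℂ) f y) :
    (dFun (fun z => f z - a) : DForm E Y 1).val y = (dFun f : DForm E Y 1).val y := by
  have h1 : tangentMapAt E ℂ (fun z => f z - a) y = tangentMapAt E ℂ f y := by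
    have h2 := (hf.hasMFDerivAt.sub (hasMFDerivAt_const a y)).mfderiv
    exact h2.trans (sub_zero (tangentMapAt E ℂ f y))
  rw [dFun_val, dFun_val, h1]

section Tube

variable [FiniteDimensional ℝ E] [FiniteDimensional ℝ E'] [FiniteDimensional ℝ F]
  [IsManifold 𝓘(ℝ, E) ∞ Y] [IsManifold 𝓘(ℝ, E') ∞ D]

/-- On the tube, with a branch `v` of the twist, the primitive is `v γ` and the Leray form `v dγ`
for a smooth form `γ`. -/
theorem IsTubularNeighbourhood.exists_lerayForm_eq (hU : IsTubularNeighbourhood E E' F i U π)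
    (hθ : IsStep (E := E) i N U θ)
    (hi : ContMDiff 𝓘(ℝ, E') 𝓘(ℝ, E) ∞ i) (hω : ω₀ ∈ smoothForms E Y 1) (hdω : extD ω₀ = 0)
    (hψ : ψ ∈ smoothForms E' D p) (hdψ : covD (pullback (E := E') i ω₀) ψ = 0) {y : Y}
    (hy : y ∈ U) :
    ∃ (V : Set Y) (v : Y → ℂ) (γ : DForm E Y p), y ∈ V ∧ IsBranch ω₀ V v ∧
      (∀ z ∈ V, SmoothFormAt γ z) ∧
      (∀ z ∈ V, (lerayPrimitive ω₀ i U π θ ψ).val z = (fsmul v γ).val z) ∧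
      ∀ z ∈ V, (lerayForm ω₀ i U π θ ψ).val z = (fsmul v (extD γ)).val z := by
  obtain ⟨V, v, β, hyV, hv, hP, hβ⟩ := hU.exists_twistPullback_eq hi hω hdω hψ hdψ hy
  have hτ : ContMDiff 𝓘(ℝ, E) 𝓘(ℝ, ℂ) ∞ fun z => (θ z : ℂ) - 1 :=
    hθ.contMDiff_ofReal.sub contMDiff_const
  refine ⟨V, v, fsmul (fun z => (θ z : ℂ) - 1) β, hyV, hv,
    fun z hz => (hβ z hz).1.fsmul (hτ z), fun z hz => ?_, fun z hz => ?_⟩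
  · have h1 : (lerayPrimitive ω₀ i U π θ ψ).val z
      = ((θ z : ℂ) - 1) • (twistPullback ω₀ i U π ψ).val z := rfl
    have h2 : (fsmul v β).val z = v z • β.val z := rfl
    rw [h1, hP z hz, h2, smul_comm]
    rfl
  · have h2 : (fsmul v β).val z = v z • β.val z := rfl
    have h3 : (fsmul v (extD (fsmul (fun z => (θ z : ℂ) - 1) β))).val z
      = v z • (extD (fsmul (fun z => (θ z : ℂ) - 1) β)).val z := rfl
    -- Closedness of β removes the term (θ-1) dβ of the Leibniz rule and leaves dθ ∧ β.
    rw [h3, extD_fsmul (hτ z) (hβ z hz).1, (hβ z hz).2, alt_smul_zero, add_zero,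
      dFun_sub_const 1 ((hθ.contMDiff_ofReal z).mdifferentiableAt (by simp)), lerayForm_val, hP z hz,
      h2, wedgeAlt_smul]

theorem smoothFormAt_zero (y : Y) : SmoothFormAt (0 : DForm E Y p) y :=
  mem_smoothForms_iff.1 (Submodule.zero_mem _) y

variable (hU : IsTubularNeighbourhood E E' F i U π) (hθ : IsStep (E := E) i N U θ)
  (hi : ContMDiff 𝓘(ℝ, E') 𝓘(ℝ, E) ∞ i) (hω : ω₀ ∈ smoothForms E Y 1) (hdω : extD ω₀ = 0)
  (hψ : ψ ∈ smoothForms E' D p) (hdψ : covD (pullback (E := E') i ω₀) ψ = 0)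

include hU hθ hi hω hdω hψ hdψ

theorem lerayPrimitive_mem_smoothForms : lerayPrimitive ω₀ i U π θ ψ ∈ smoothForms E Y p := by
  refine mem_smoothForms_iff.2 fun y => ?_
  by_cases hy : y ∈ U
  · obtain ⟨V, v, γ, hyV, hv, hγ, hprim, -⟩ := hU.exists_lerayForm_eq hθ hi hω hdω hψ hdψ hy
    exact ((hγ y hyV).fsmul (hv.contMDiffAt hyV)).congr
      (by filter_upwards [hv.isOpen.mem_nhds hyV] using hprim)
  · exact (smoothFormAt_zero y).congr (hθ.lerayPrimitive_eventually_eq_zero hy)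

theorem lerayForm_mem_smoothForms : lerayForm ω₀ i U π θ ψ ∈ smoothForms E Y (p + 1) := by
  refine mem_smoothForms_iff.2 fun y => ?_
  by_cases hy : y ∈ U
  · obtain ⟨V, v, γ, hyV, hv, hγ, -, hform⟩ := hU.exists_lerayForm_eq hθ hi hω hdω hψ hdψ hy
    have hV := hv.isOpen.mem_nhds hyV
    exact ((SmoothFormAt.extD (by filter_upwards [hV] using hγ)).fsmul (hv.contMDiffAt hyV)).congr
      (by filter_upwards [hV] using hform)
  · exact (smoothFormAt_zero y).congr (hθ.lerayForm_eventually_eq_zero hy)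

/-- On the tube this is ∇(vγ) = v dγ; off it both sides vanish. -/
theorem covD_lerayPrimitive :
    covD ω₀ (lerayPrimitive ω₀ i U π θ ψ) = lerayForm ω₀ i U π θ ψ := by
  funext y
  change (covD ω₀ (lerayPrimitive ω₀ i U π θ ψ)).val y = (lerayForm ω₀ i U π θ ψ).val y
  by_cases hy : y ∈ U
  · obtain ⟨V, v, γ, hyV, hv, hγ, hprim, hform⟩ := hU.exists_lerayForm_eq hθ hi hω hdω hψ hdψ hy
    rw [covD_val_congr _ (by filter_upwards [hv.isOpen.mem_nhds hyV] using hprim),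
      hv.covD_fsmul hyV (hγ y hyV), hform y hyV]
    rfl
  · rw [covD_val_congr _ (hθ.lerayPrimitive_eventually_eq_zero hy), covD_zero,
      (hθ.lerayForm_eventually_eq_zero hy).self_of_nhds]

/-- On the tube ∇(v dγ) = v d²γ = 0; off it the form vanishes near each point. -/
theorem covD_lerayForm : covD ω₀ (lerayForm ω₀ i U π θ ψ) = 0 := by
  funext y
  change (covD ω₀ (lerayForm ω₀ i U π θ ψ)).val y = 0
  by_cases hy : y ∈ U
  · obtain ⟨V, v, γ, hyV, hv, hγ, -, hform⟩ := hU.exists_lerayForm_eq hθ hi hω hdω hψ hdψ hy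
    have hγ' : ∀ᶠ z in 𝓝 y, SmoothFormAt γ z := by
      filter_upwards [hv.isOpen.mem_nhds hyV] using hγ
    rw [covD_val_congr _ (by filter_upwards [hv.isOpen.mem_nhds hyV] using hform),
      hv.covD_fsmul hyV (SmoothFormAt.extD hγ'), extD_extD hγ', alt_smul_zero]
  · rw [covD_val_congr _ (hθ.lerayForm_eventually_eq_zero hy), covD_zero]
    rfl

-- At a point of D the fibre transport is trivial, so the ratio is `v/v = 1`; the factor θ-1 is -1,
-- and `π ∘ i = id` turns `i^* π^* ψ` into ψ.
omit hψ hdψ in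
theorem pullback_lerayPrimitive : pullback (E := E') i (lerayPrimitive ω₀ i U π θ ψ) = -ψ := by
  funext x
  obtain ⟨B, -, hxB, v, hv⟩ := hU.exists_isBranch hω hdω x
  have hr : twistRatio ω₀ i U π (i x) = 1 := by
    have hV : U ∩ π ⁻¹' {π (i x)} ⊆ U ∩ π ⁻¹' B := fun z hz =>
      ⟨hz.1, by rw [Set.mem_preimage, show π z = π (i x) from hz.2, hU.proj_incl]; exact hxB⟩
    rw [hU.twistRatio_eq hv (hU.incl_mem x) hV, hU.proj_incl]
    exact div_self (hv.ne_zero _ ⟨hU.incl_mem x, by rwa [Set.mem_preimage, hU.proj_incl]⟩)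
  have h1 : (pullback (E := E') i (lerayPrimitive ω₀ i U π θ ψ)).val x
      = ((θ (i x) : ℂ) - 1) • twistRatio ω₀ i U π (i x) •
        (pullback (E := E') i (pullback (E := E) π ψ)).val x := rfl
  have h2 : π ∘ i = id := funext hU.proj_incl
  have h3 : (pullback (E := E') i (lerayPrimitive ω₀ i U π θ ψ)).val x = -ψ.val x := by
    rw [h1, hr, hθ.eq_zero _ (hθ.incl_mem x),
      ← pullback_comp_val ((hU.contMDiffAt_proj (hU.incl_mem x)).mdifferentiableAt (by simp))
        ((hi x).mdifferentiableAt (by simp)), h2, pullback_id_val, one_smul, Complex.ofReal_zero,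
      zero_sub, alt_neg_one_smul]
  exact h3

end Tube

theorem pullback_lerayForm (hθ : IsStep (E := E) i N U θ) :
    pullback (E := E') i (lerayForm ω₀ i U π θ ψ) = 0 := by
  funext x
  have h : (pullback (E := E') i (lerayForm ω₀ i U π θ ψ)).val x = 0 := by
    rw [pullback_val, hθ.lerayForm_eq_zero_of_mem (hθ.incl_mem x)]
    rfl
  exact h

end LerayForm

end Leray

end

/-! ### Assembly in relative cohomology. -/

theorem mainTheorem2
    {E : Type*} [NormedAddCommGroup E] [NormedSpace ℝ E] [FiniteDimensional ℝ E]
    {Y : Type*} [TopologicalSpace Y] [ChartedSpace E Y] [IsManifold 𝓘(ℝ, E) ∞ Y]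
    {E' : Type*} [NormedAddCommGroup E'] [NormedSpace ℝ E'] [FiniteDimensional ℝ E']
    {D : Type*} [TopologicalSpace D] [ChartedSpace E' D] [IsManifold 𝓘(ℝ, E') ∞ D]
    [CompactSpace D]
    {F : Type*} [NormedAddCommGroup F] [NormedSpace ℝ F] [FiniteDimensional ℝ F]
    (i : D → Y) (hi : Manifold.IsSmoothEmbedding 𝓘(ℝ, E') 𝓘(ℝ, E) ∞ i)
    (U : Set Y) (π : Y → D) (hU : Leray.IsTubularNeighbourhood E E' F i U π)
    (ω₀ : Leray.DForm E Y 1) (hω : ω₀ ∈ Leray.smoothForms E Y 1) (hdω : Leray.extD ω₀ = 0)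
    (N : Set Y) (θ : Y → ℝ) (hθ : Leray.IsStep (E := E) i N U θ)
    (p : ℕ) (ψ : Leray.DForm E' D p) (hψ : ψ ∈ Leray.cocycles (Leray.pullback i ω₀) p) :
    (∀ y ∈ U, ∃! z : ℂ, Leray.IsTwistRatio ω₀ i U π y z) ∧
    (∃ h : (Leray.lerayForm ω₀ i U π θ ψ, 0) ∈ Leray.relCocycles (E := E') i ω₀ p,
      (Submodule.Quotient.mk ⟨_, h⟩ : Leray.RelCohomology (E := E') i ω₀ p)
        = Leray.lerayMap i ω₀ p (Submodule.Quotient.mk ⟨ψ, hψ⟩)) ∧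
    (∀ y ∈ N, Leray.lerayForm ω₀ i U π θ ψ y = 0) ∧
    Leray.lerayPrimitive ω₀ i U π θ ψ ∈ Leray.smoothForms E Y p ∧
    ((Leray.lerayForm ω₀ i U π θ ψ, 0) - (0, ψ) : Leray.DForm E Y (p + 1) × Leray.DForm E' D p)
      = (Leray.covD ω₀ (Leray.lerayPrimitive ω₀ i U π θ ψ),
          Leray.pullback i (Leray.lerayPrimitive ω₀ i U π θ ψ)) := by
  obtain ⟨ψ', hψ', rfl⟩ := id hψ
  have hdψ : Leray.covD (Leray.pullback (E := E') i ω₀) ψ'.1 = 0 := hψ'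
  have him : ContMDiff 𝓘(ℝ, E') 𝓘(ℝ, E) ∞ i := hi.contMDiff
  have hprim := Leray.lerayPrimitive_mem_smoothForms hU hθ him hω hdω ψ'.2 hdψ
  have hform := Leray.lerayForm_mem_smoothForms hU hθ him hω hdω ψ'.2 hdψ
  have hclosed := Leray.covD_lerayForm hU hθ him hω hdω ψ'.2 hdψ
  have heq : ((Leray.lerayForm ω₀ i U π θ ψ'.1, 0) - (0, ψ'.1) :
      Leray.DForm E Y (p + 1) × Leray.DForm E' D p)
      = (Leray.covD ω₀ (Leray.lerayPrimitive ω₀ i U π θ ψ'.1),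
          Leray.pullback i (Leray.lerayPrimitive ω₀ i U π θ ψ'.1)) := by
    rw [Leray.covD_lerayPrimitive hU hθ him hω hdω ψ'.2 hdψ,
      Leray.pullback_lerayPrimitive hU hθ him hω hdω, Prod.mk_sub_mk, sub_zero, zero_sub]
  have hrel : (Leray.lerayForm ω₀ i U π θ ψ'.1, 0) ∈ Leray.relCocycles (E := E') i ω₀ p := by
    refine ⟨(⟨_, hform⟩, 0), ?_, rfl⟩
    have h1 : Leray.nabla ω₀ ⟨_, hform⟩ = 0 := hclosed
    -- The second component of the relative derivative is the restriction to D, zero because D lies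
    -- in `N`.
    have h2 := Leray.pullback_lerayForm (E' := E') (ω₀ := ω₀) (π := π) (ψ := ψ'.1) hθ
    simp [Leray.relNabla, h1, h2]
  refine ⟨fun y hy => hU.existsUnique_isTwistRatio hω hdω hy, ⟨hrel, ?_⟩,
    fun y hy => hθ.lerayForm_eq_zero_of_mem hy, hprim, heq⟩
  refine (Submodule.Quotient.eq _).2 ?_
  change ((Leray.lerayForm ω₀ i U π θ ψ'.1, 0) - (0, ψ'.1) :
      Leray.DForm E Y (p + 1) × Leray.DForm E' D p) ∈ Leray.relCoboundaries (E := E') i ω₀ p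
  rw [heq]
  -- The primitive alone bounds the difference; no form on D of degree p-1 enters, so p = 0 needs no
  -- separate treatment.
  exact Submodule.mem_sup_left ⟨⟨_, hprim⟩, rfl⟩
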